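/- Let $\Gamma\subset\mathbb{R}^3$ be a closed surface (compact, without boundary, embedded, of class $C^2$) with area measure $\sigma$, let $P(x)=I-n(x)n(x)^{\mathsf T}$ be the orthogonal projection onto the tangent plane $T_x\Gamma$ ($n$ a unit normal), $\nabla_\Gamma=P\nabla$ the tangential gradient and $\operatorname{div}_\Gamma=\operatorname{trace}(\nabla_\Gamma)$ the tangential divergence. Let $\eta>0$ and let $\rho_0,\rho_1:\Gamma\to\mathbb{R}$ be continuous. Consider flows $(\rho,v,g)$ on $[0,1]\times\Gamma$ with $\rho>0$ of class $C^1$, $v$ a tangential vector field of class $C^1$ and $g$ a continuous real function, and multipliers $(\phi,\phi_1,\phi_2)$ with $\phi:[0,1]\times\Gamma\to\mathbb{R}$ of class $C^1$ and $\phi_1,\phi_2:\Gamma\to\mathbb{R}$ continuous. The dynamic unbalanced optimal transport problem on $\Gamma$ (dynamic MUOT) is to minimize $$J(\rho,v,g)=\int_0^1\!\int_\Gamma \tfrac12\rho\|v\|^2+\tfrac1\eta\rho g^2\,d\sigma\,dt$$ over the set $\mathcal{C}(\rho_0,\rho_1)$ of all such flows with $\partial_t\rho+\operatorname{div}_\Gamma(\rho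 v)=\rho g$ on $(0,1)\times\Gamma$, $\rho(0,\cdot)=\rho_0$ and $\rho(1,\cdot)=\rho_1$ on $\Gamma$. Its Lagrangian is $$L(\rho,v,g,\phi,\phi_1,\phi_2)=J(\rho,v,g)+\int_0^1\!\int_\Gamma\phi\,[\partial_t\rho+\operatorname{div}_\Gamma(\rho v)-\rho g]\,d\sigma\,dt+\int_\Gamma\phi_1(\rho(0,\cdot)-\rho_0)\,d\sigma+\int_\Gamma\phi_2(\rho(1,\cdot)-\rho_1)\,d\sigma .$$ **Theorem.** Let $(\hat\rho,\hat v,\hat g,\hat\phi,\hat\phi_1,\hat\phi_2)$ be a saddle point of $L$, that is, a flow and a multiplier as above with $$L(\hat\rho,\hat v,\hat g,\phi,\phi_1,\phi_2)\le L(\hat\rho,\hat v,\hat g,\hat\phi,\hat\phi_1,\hat\phi_2)\le L(\rho,v,g,\hat\phi,\hat\phi_1,\hat\phi_2)$$ for all flows $(\rho,v,g)$ and all multipliers $(\phi,\phi_1,\phi_2)$ as above. Then $\hat v=\nabla_\Gamma\hat\phi$ and $\hat g=\frac{\eta}{2}\hat\phi$ on $[0,1]\times\Gamma$, and $(\rho,\phi)=(\hat\rho,\hat\phi)$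 is a classical solution (with $\rho>0$ and $\rho,\phi,\nabla_\Gamma\phi$ of class $C^1$ on $[0,1]\times\Gamma$) of the dynamic KKT-MUOT system $$\begin{aligned} \partial_t\rho+\operatorname{div}_\Gamma(\rho\nabla_\Gamma\phi)&=\tfrac{\eta}{2}\rho\phi &&\text{on }(0,1)\times\Gamma,\\ \partial_t\phi+\tfrac12\|\nabla_\Gamma\phi\|^2&=-\tfrac{\eta}{4}\phi^2 &&\text{on }[0,1]\times\Gamma,\\ \rho(0,\cdot)=\rho_0,\quad \rho(1,\cdot)&=\rho_1 &&\text{on }\Gamma . \end{aligned}$$ Moreover $(\hat\rho,\hat v,\hat g)=(\hat\rho,\nabla_\Gamma\hat\phi,\frac{\eta}{2}\hat\phi)$ is optimal for the dynamic MUOT problem: it belongs to $\mathcal{C}(\rho_0,\rho_1)$ and $J(\hat\rho,\hat v,\hat g)\le J(\rho,v,g)$ for every $(\rho,v,g)\in\mathcal{C}(\rho_0,\rho_1)$. -/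

import Mathlib

open Set MeasureTheory

noncomputable section

namespace MUOT

/-- Three-dimensional Euclidean space. -/
abbrev E3 : Type := EuclideanSpace ℝ (Fin 3)

/-- A closed surface: a compact subset of `ℝ³` without boundary which near each of its points is the
zero set of a `C²` function with nowhere vanishing differential. -/
structure IsClosedSurface (Γ : Set E3) : Prop where
  isCompact : IsCompact Γ
  exists_local_equation : ∀ p ∈ Γ, ∃ (U : Set E3) (F : E3 → ℝ), IsOpen U ∧ p ∈ U ∧
    ContDiffOn ℝ 2 F U ∧ (∀ x ∈ U, fderiv ℝ F x ≠ 0) ∧ Γ ∩ U = {x ∈ U | F x = 0}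

/-- The area measure `σ` of `Γ`: the two-dimensional Hausdorff measure restricted to `Γ`, normalized
so that it is Lebesgue measure on the Euclidean plane. -/
def surfaceMeasure (Γ : Set E3) : Measure E3 :=
  (Measure.euclideanHausdorffMeasure 2 : Measure E3).restrict Γ

/-- The tangent plane `T_x Γ`, as a linear subspace of `ℝ³`. -/
def tangentPlane (Γ : Set E3) (x : E3) : Submodule ℝ E3 :=
  Submodule.span ℝ (tangentConeAt ℝ Γ x)

/-- The orthogonal projection `P(x) = I - n(x) n(x)ᵀ` of `ℝ³` onto the tangent plane `T_x Γ`. -/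
def tangentProj (Γ : Set E3) (x : E3) : E3 →L[ℝ] E3 :=
  (tangentPlane Γ x).starProjection

/-- The tangential gradient `∇_Γ f (x) = P(x) ∇f(x)`. A derivative of `f` within `Γ` is determined
only on the tangent plane, and only that part of it survives the projection. -/
def surfaceGrad (Γ : Set E3) (f : E3 → ℝ) (x : E3) : E3 :=
  tangentProj Γ x (gradientWithin f Γ x)

/-- The tangential divergence `div_Γ F (x)`, the trace of the tangential derivative `DF(x) ∘ P(x)`. -/
def surfaceDiv (Γ : Set E3) (F : E3 → E3) (x : E3) : ℝ :=
  LinearMap.trace ℝ E3 ((fderivWithin ℝ F Γ x ∘L tangentProj Γ x : E3 →L[ℝ] E3) : E3 →ₗ[ℝ] E3)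

/-- The time derivative `∂_t f (t, x)` on `[0, 1]`, one-sided at the end points. -/
def timeDeriv (f : ℝ → E3 → ℝ) (t : ℝ) (x : E3) : ℝ :=
  derivWithin (fun s => f s x) (Icc 0 1) t

/-- The primal variables: density `ρ`, velocity `v`, growth rate `g`, functions of `(t, x)`. Only the
values on `[0, 1] × Γ` matter. -/
structure Flow where
  ρ : ℝ → E3 → ℝ
  v : ℝ → E3 → E3
  g : ℝ → E3 → ℝ

/-- The dual variables: `φ` on `[0, 1] × Γ`, and `φ₁`, `φ₂` on `Γ`. -/
structure Multiplier where
  φ : ℝ → E3 → ℝ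
  φ₁ : E3 → ℝ
  φ₂ : E3 → ℝ

/-- `ρ` is `C¹` and positive, `v` is a `C¹` tangential field, `g` is continuous. -/
structure IsAdmissibleFlow (Γ : Set E3) (u : Flow) : Prop where
  contDiffOn_ρ : ContDiffOn ℝ 1 (fun z : ℝ × E3 => u.ρ z.1 z.2) (Icc 0 1 ×ˢ Γ)
  ρ_pos : ∀ t ∈ Icc (0 : ℝ) 1, ∀ x ∈ Γ, 0 < u.ρ t x
  contDiffOn_v : ContDiffOn ℝ 1 (fun z : ℝ × E3 => u.v z.1 z.2) (Icc 0 1 ×ˢ Γ)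
  v_mem : ∀ t ∈ Icc (0 : ℝ) 1, ∀ x ∈ Γ, u.v t x ∈ tangentPlane Γ x
  continuousOn_g : ContinuousOn (fun z : ℝ × E3 => u.g z.1 z.2) (Icc 0 1 ×ˢ Γ)

/-- `φ` is `C¹`, and `φ₁`, `φ₂` are continuous. -/
structure IsAdmissibleMultiplier (Γ : Set E3) (p : Multiplier) : Prop where
  contDiffOn_φ : ContDiffOn ℝ 1 (fun z : ℝ × E3 => p.φ z.1 z.2) (Icc 0 1 ×ˢ Γ)
  continuousOn_φ₁ : ContinuousOn p.φ₁ Γ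
  continuousOn_φ₂ : ContinuousOn p.φ₂ Γ

/-- `∂_t ρ + div_Γ (ρ v) - ρ g`. -/
def continuityResidual (Γ : Set E3) (u : Flow) (t : ℝ) (x : E3) : ℝ :=
  timeDeriv u.ρ t x + surfaceDiv Γ (fun y => u.ρ t y • u.v t y) x - u.ρ t x * u.g t x

/-- The objective `∫₀¹ ∫_Γ ½ ρ |v|² + (1/η) ρ g² dσ dt`. -/
def cost (Γ : Set E3) (η : ℝ) (u : Flow) : ℝ :=
  ∫ t in (0 : ℝ)..1, ∫ x, (1 / 2 * u.ρ t x * ‖u.v t x‖ ^ 2 + 1 / η * u.ρ t x * u.g t x ^ 2)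
    ∂(surfaceMeasure Γ)

/-- The constraint set `𝒞(ρ₀, ρ₁)`. -/
def feasible (Γ : Set E3) (ρ₀ ρ₁ : E3 → ℝ) : Set Flow :=
  {u | IsAdmissibleFlow Γ u ∧
    (∀ t ∈ Ioo (0 : ℝ) 1, ∀ x ∈ Γ,
      timeDeriv u.ρ t x + surfaceDiv Γ (fun y => u.ρ t y • u.v t y) x = u.ρ t x * u.g t x) ∧
    (∀ x ∈ Γ, u.ρ 0 x = ρ₀ x) ∧ (∀ x ∈ Γ, u.ρ 1 x = ρ₁ x)}

/-- The Lagrangian of the dynamic unbalanced optimal transport problem on `Γ`. -/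
def lagrangian (Γ : Set E3) (η : ℝ) (ρ₀ ρ₁ : E3 → ℝ) (u : Flow) (p : Multiplier) : ℝ :=
  cost Γ η u
    + (∫ t in (0 : ℝ)..1, ∫ x, p.φ t x * continuityResidual Γ u t x ∂(surfaceMeasure Γ))
    + (∫ x, p.φ₁ x * (u.ρ 0 x - ρ₀ x) ∂(surfaceMeasure Γ))
    + (∫ x, p.φ₂ x * (u.ρ 1 x - ρ₁ x) ∂(surfaceMeasure Γ))

/-- `(u, p)` is a saddle point of the Lagrangian: `u` minimizes `L(·, p)` and `p` maximizes
`L(u, ·)` over the admissible variables. -/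
structure IsLagrangianSaddlePoint (Γ : Set E3) (η : ℝ) (ρ₀ ρ₁ : E3 → ℝ)
    (u : Flow) (p : Multiplier) : Prop where
  admissible_flow : IsAdmissibleFlow Γ u
  admissible_multiplier : IsAdmissibleMultiplier Γ p
  isSaddlePointOn : IsSaddlePointOn {u' | IsAdmissibleFlow Γ u'}
    {p' | IsAdmissibleMultiplier Γ p'} (lagrangian Γ η ρ₀ ρ₁) u p

/-- `(ρ, φ)` is a classical solution, with positive density, of the dynamic KKT-MUOT system. -/
structure IsKKTSolution (Γ : Set E3) (η : ℝ) (ρ₀ ρ₁ : E3 → ℝ) (ρ φ : ℝ → E3 → ℝ) : Prop where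
  contDiffOn_ρ : ContDiffOn ℝ 1 (fun z : ℝ × E3 => ρ z.1 z.2) (Icc 0 1 ×ˢ Γ)
  ρ_pos : ∀ t ∈ Icc (0 : ℝ) 1, ∀ x ∈ Γ, 0 < ρ t x
  contDiffOn_φ : ContDiffOn ℝ 1 (fun z : ℝ × E3 => φ z.1 z.2) (Icc 0 1 ×ˢ Γ)
  contDiffOn_grad_φ :
    ContDiffOn ℝ 1 (fun z : ℝ × E3 => surfaceGrad Γ (φ z.1) z.2) (Icc 0 1 ×ˢ Γ)
  continuity : ∀ t ∈ Ioo (0 : ℝ) 1, ∀ x ∈ Γ,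
    timeDeriv ρ t x + surfaceDiv Γ (fun y => ρ t y • surfaceGrad Γ (φ t) y) x
      = η / 2 * ρ t x * φ t x
  hamilton_jacobi : ∀ t ∈ Icc (0 : ℝ) 1, ∀ x ∈ Γ,
    timeDeriv φ t x + 1 / 2 * ‖surfaceGrad Γ (φ t) x‖ ^ 2 = -(η / 4) * φ t x ^ 2
  initial : ∀ x ∈ Γ, ρ 0 x = ρ₀ x
  terminal : ∀ x ∈ Γ, ρ 1 x = ρ₁ x

end MUOT

end

/-! The Lagrangian is quadratic in `v` and in `g`, affine in `ρ`, and affine in the multipliers, so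
a saddle point is characterized by first variations, each of which must vanish. Integrating by
parts, the interior part of the Lagrangian is formally the integral of `ρ (½|v|² + g²/η - ∂_t φ -
∇_Γ φ · v - φ g)`, up to terms at `t = 0, 1`. Varying `g` gives `g = (η/2) φ`; varying `v` among
tangential fields gives `v = ∇_Γ φ`; varying `ρ` makes the bracket vanish, and inserting the first
two identities turns it into the Hamilton-Jacobi equation. Varying `φ`, `φ₁`, `φ₂` returns the
continuity equation and the end conditions. Regularity of `∇_Γ φ` is inherited from `v`. Optimality
is weak duality: on feasible flows the Lagrangian equals the cost, so minimality of `L(·, p)` at `u`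
is minimality of the cost.

The variations are made rigorous by `integral_firstVariation_eq_zero` together with the fundamental
lemma `eqOn_zero_of_forall_integral_mul_eq_zero`, which needs every nonempty relatively open piece
of `[0, 1] × Γ` to have positive measure.

The geometric input is the divergence theorem `IsClosedSurface.integral_surfaceDiv_eq_zero` for
tangential `C¹` fields. Locally `Γ` is a graph of some `h` with area density `J = √(1 + |∇h|²)`. The
area formula `map_restrict_image_graphMap` identifies Hausdorff measure on the graph with `J dy`,
and `density_mul_surfaceDiv` identifies `J div_Γ W` with the plane divergence of `J` times the
horizontal part of `W`. A partition of unity then globalizes. The `C²` assumption enters through the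
symmetry of `D²h` and through `P` being `C¹`, which makes `χ P e` an admissible velocity variation.
-/

noncomputable section

namespace MUOT

/-! ### Orthonormal frames, linear graph maps and comparison of Hausdorff measures. -/

section

open Metric Filter Topology
open scoped NNReal ENNReal RealInnerProductSpace

/-- The Euclidean plane, over which a surface is locally a graph. -/
abbrev Plane : Type := EuclideanSpace ℝ (Fin 2)

/-- An orthonormal splitting of `ℝ³` into a vertical line spanned by `n` and a horizontal plane, the
range of `ι`, with `L` the orthogonal projection to the plane. -/
structure NormalFrame where
  n : E3
  ι : Plane →ₗᵢ[ℝ] E3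
  L : E3 →L[ℝ] Plane
  norm_n : ‖n‖ = 1
  inner_ι : ∀ y, ⟪n, ι y⟫ = 0
  decomp : ∀ x, ι (L x) + ⟪n, x⟫ • n = x

namespace NormalFrame

variable (φ : NormalFrame)

lemma inner_self_n : ⟪φ.n, φ.n⟫ = (1 : ℝ) := by
  rw [real_inner_self_eq_norm_sq, φ.norm_n, one_pow]

@[simp] lemma L_ι (y : Plane) : φ.L (φ.ι y) = y := by
  have h := φ.decomp (φ.ι y)
  rw [φ.inner_ι, zero_smul, add_zero] at h
  exact φ.ι.injective h

@[simp] lemma L_n : φ.L φ.n = 0 := by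
  have h := φ.decomp φ.n
  rw [φ.inner_self_n, one_smul, add_eq_right] at h
  exact φ.ι.injective (by rw [h, map_zero])

lemma inner_ι_left (y : Plane) (x : E3) : ⟪φ.ι y, x⟫ = ⟪y, φ.L x⟫ := by
  conv_lhs => rw [← φ.decomp x]
  rw [inner_add_right, φ.ι.inner_map_map, inner_smul_right, real_inner_comm φ.n, φ.inner_ι]
  simp

lemma norm_sq_eq (x : E3) : ‖x‖ ^ 2 = ‖φ.L x‖ ^ 2 + ⟪φ.n, x⟫ ^ 2 := by
  have h : ⟪x, x⟫ = ⟪φ.L x, φ.L x⟫ + ⟪φ.n, x⟫ ^ 2 := by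
    nth_rewrite 1 [← φ.decomp x]
    rw [inner_add_left, φ.inner_ι_left, inner_smul_left]
    simp [sq]
  simpa [real_inner_self_eq_norm_sq] using h

lemma norm_L_le (x : E3) : ‖φ.L x‖ ≤ ‖x‖ := by
  have := φ.norm_sq_eq x
  nlinarith [norm_nonneg x, norm_nonneg (φ.L x), sq_nonneg (⟪φ.n, x⟫ : ℝ)]

/-- Every unit vector is the vertical direction of a splitting. -/
theorem exists_of_norm_eq_one {n : E3} (hn : ‖n‖ = 1) : ∃ φ : NormalFrame, φ.n = n := by
  have hn0 : n ≠ 0 := fun h => by simp [h] at hn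
  have hfin : Module.finrank ℝ (ℝ ∙ n)ᗮ = 2 := by
    have := Submodule.finrank_add_finrank_orthogonal (ℝ ∙ n)
    rw [finrank_span_singleton hn0, finrank_euclideanSpace_fin] at this
    omega
  let e : Plane ≃ₗᵢ[ℝ] (ℝ ∙ n)ᗮ :=
    ((stdOrthonormalBasis ℝ (ℝ ∙ n)ᗮ).reindex (finCongr hfin)).repr.symm
  let ι : Plane →ₗᵢ[ℝ] E3 := (ℝ ∙ n)ᗮ.subtypeₗᵢ.comp e.toLinearIsometry
  refine ⟨⟨n, ι, e.symm.toContinuousLinearEquiv.toContinuousLinearMap ∘L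
    (ℝ ∙ n)ᗮ.orthogonalProjectionOnto, hn, fun y => ?_, fun x => ?_⟩, rfl⟩
  · exact Submodule.mem_orthogonal_singleton_iff_inner_right.1 (e y).2
  · have h1 : ι ((e.symm.toContinuousLinearEquiv.toContinuousLinearMap ∘L
        (ℝ ∙ n)ᗮ.orthogonalProjectionOnto) x) = (ℝ ∙ n)ᗮ.starProjection x := by
      change ((e (e.symm ((ℝ ∙ n)ᗮ.orthogonalProjectionOnto x)) : (ℝ ∙ n)ᗮ) : E3) = _
      rw [e.apply_symm_apply]; rfl
    have h2 : (ℝ ∙ n).starProjection x = (⟪n, x⟫ : ℝ) • n := by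
      rw [Submodule.starProjection_unit_singleton ℝ hn]
    rw [h1, ← h2, add_comm]
    exact Submodule.starProjection_add_starProjection_orthogonal x

/-- The graph map `y ↦ ι y + h y • n`. -/
def graphMap (h : Plane → ℝ) (y : Plane) : E3 := φ.ι y + h y • φ.n

@[simp] lemma L_graphMap (h : Plane → ℝ) (y : Plane) : φ.L (φ.graphMap h y) = y := by
  simp [graphMap]

@[simp] lemma inner_n_graphMap (h : Plane → ℝ) (y : Plane) : ⟪φ.n, φ.graphMap h y⟫ = h y := by
  rw [graphMap, inner_add_right, φ.inner_ι, inner_smul_right, φ.inner_self_n]; simp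

/-- The linear graph map of a slope `a`. -/
def graphLin (a : Plane →L[ℝ] ℝ) : Plane →L[ℝ] E3 :=
  φ.ι.toContinuousLinearMap + a.smulRight φ.n

@[simp] lemma graphLin_apply (a : Plane →L[ℝ] ℝ) (z : Plane) :
    φ.graphLin a z = φ.ι z + a z • φ.n := by
  simp [graphLin]

lemma L_graphLin (a : Plane →L[ℝ] ℝ) (z : Plane) : φ.L (φ.graphLin a z) = z := by
  simp

lemma inner_graphLin (a : Plane →L[ℝ] ℝ) (z w : Plane) :
    ⟪φ.graphLin a z, φ.graphLin a w⟫ = ⟪z, w⟫ + a z * a w := by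
  simp only [graphLin_apply, inner_add_left, inner_add_right, φ.ι.inner_map_map, inner_smul_left,
    inner_smul_right, φ.inner_ι, φ.inner_self_n, real_inner_comm φ.n]
  simp [mul_comm]

lemma norm_le_norm_graphLin (a : Plane →L[ℝ] ℝ) (z : Plane) : ‖z‖ ≤ ‖φ.graphLin a z‖ := by
  simpa [L_graphLin] using φ.norm_L_le (φ.graphLin a z)

/-- With `b` the vector representing `a`, the Gram operator of the graph map is `z ↦ z + a(z) b`, a
rank-one perturbation of the identity with determinant `1 + a(b) = 1 + ‖a‖²`. -/
lemma normDet_graphLin (a : Plane →L[ℝ] ℝ) :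
    (φ.graphLin a : Plane →ₗ[ℝ] E3).normDet = √(1 + ‖a‖ ^ 2) := by
  rw [eq_comm, Real.sqrt_eq_iff_mul_self_eq (by positivity) (LinearMap.normDet_nonneg _), ← sq]
  have h := (φ.graphLin a : Plane →ₗ[ℝ] E3).normDet_sq
  simp only [RCLike.ofReal_real_eq_id, id] at h
  rw [h]
  set b := (InnerProductSpace.toDual ℝ Plane).symm a
  have hab : ∀ z, a z = ⟪b, z⟫ := fun z => (InnerProductSpace.toDual_symm_apply).symm
  have hA : ((φ.graphLin a : Plane →ₗ[ℝ] E3).adjoint ∘ₗ (φ.graphLin a : Plane →ₗ[ℝ] E3))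
      = LinearMap.transvection (a : Plane →ₗ[ℝ] ℝ) b := by
    ext1 z
    refine ext_inner_right ℝ fun w => ?_
    rw [LinearMap.comp_apply, LinearMap.adjoint_inner_left]
    simp only [ContinuousLinearMap.coe_coe, inner_graphLin, LinearMap.transvection.apply,
      inner_add_left, inner_smul_left, hab]
    simp
  rw [hA, LinearMap.transvection.det]
  simp only [ContinuousLinearMap.coe_coe, hab, real_inner_self_eq_norm_sq]
  simp [b]

lemma measure_image_graphLin (a : Plane →L[ℝ] ℝ) (B : Set Plane) :
    Measure.euclideanHausdorffMeasure 2 (φ.graphLin a '' B)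
      = ENNReal.ofReal √(1 + ‖a‖ ^ 2) * volume B := by
  have h := (φ.graphLin a : Plane →ₗ[ℝ] E3).euclideanHausdorffMeasure_image_eq_normDet_mul_volume B
  rwa [normDet_graphLin, finrank_euclideanSpace_fin] at h

lemma hasFDerivAt_graphMap {h : Plane → ℝ} {h' : Plane →L[ℝ] ℝ} {y : Plane}
    (hh : HasFDerivAt h h' y) : HasFDerivAt (φ.graphMap h) (φ.graphLin h') y :=
  φ.ι.toContinuousLinearMap.hasFDerivAt.add (hh.smul_const φ.n)

lemma continuousOn_graphMap {h : Plane → ℝ} {V : Set Plane} (hh : ContinuousOn h V) :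
    ContinuousOn (φ.graphMap h) V :=
  φ.ι.continuous.continuousOn.add (hh.smul continuousOn_const)

lemma lipschitzOnWith_graphMap {h : Plane → ℝ} {V : Set Plane} {C : ℝ≥0}
    (hh : LipschitzOnWith C h V) : LipschitzOnWith (1 + C) (φ.graphMap h) V := by
  refine LipschitzOnWith.add (φ.ι.lipschitz.lipschitzOnWith) ?_
  refine LipschitzOnWith.of_dist_le_mul fun x hx y hy => ?_
  have := hh.dist_le_mul x hx y hy
  rw [dist_eq_norm, ← sub_smul, norm_smul, φ.norm_n, mul_one]
  rwa [dist_eq_norm] at this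

end NormalFrame

/-- If `f` expands distances at most `C` times more than `g`, its image has at most `C ^ d` times the
`d`-dimensional measure of the image of `g`. -/
theorem euclideanHausdorffMeasure_image_le_image {α X Y : Type*}
    [EMetricSpace X] [MeasurableSpace X] [BorelSpace X]
    [EMetricSpace Y] [MeasurableSpace Y] [BorelSpace Y] {f : α → X} {g : α → Y} {s : Set α}
    {C : ℝ≥0} (h : ∀ a ∈ s, ∀ b ∈ s, edist (f a) (f b) ≤ C * edist (g a) (g b)) (d : ℕ) :
    Measure.euclideanHausdorffMeasure d (f '' s)
      ≤ (C : ℝ≥0∞) ^ d * Measure.euclideanHausdorffMeasure d (g '' s) := by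
  rcases s.eq_empty_or_nonempty with rfl | ⟨a₀, -⟩
  · simp
  have : Nonempty α := ⟨a₀⟩
  -- The bound forces `f a = f b` whenever `g a = g b`, so on `s` the map `f` factors through `g` by
  -- a `C`-Lipschitz map `k`.
  let k : Y → X := f ∘ Function.invFunOn g s
  have hk : ∀ a ∈ s, k (g a) = f a := fun a ha => by
    have h1 : Function.invFunOn g s (g a) ∈ s := Function.invFunOn_mem ⟨a, ha, rfl⟩
    have h2 : g (Function.invFunOn g s (g a)) = g a := Function.invFunOn_eq ⟨a, ha, rfl⟩
    have h3 := h _ h1 a ha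
    rw [h2, edist_self, mul_zero, nonpos_iff_eq_zero, edist_eq_zero] at h3
    exact h3
  have himg : f '' s = k '' (g '' s) := by
    rw [image_image]
    exact image_congr fun a ha => (hk a ha).symm
  have hL : LipschitzOnWith C k (g '' s) := by
    rintro _ ⟨a, ha, rfl⟩ _ ⟨b, hb, rfl⟩
    rw [hk a ha, hk b hb]
    exact h a ha b hb
  have := hL.hausdorffMeasure_image_le (Nat.cast_nonneg d)
  rw [himg]
  simp only [Measure.euclideanHausdorffMeasure_def, Measure.smul_apply, ENNReal.smul_def,
    smul_eq_mul]
  rw [mul_left_comm]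
  gcongr
  simpa using this

end

/-! ### The area formula for `C¹` graphs. -/

section

open Metric Filter Topology
open scoped NNReal ENNReal RealInnerProductSpace

/-- Turns two-sided bounds with factor `(1 + δ)²`, as produced by Lipschitz comparison in dimension
two, into convergence of ratios. -/
lemma tendsto_of_forall_mul_le {α : Type*} {l : Filter α} {q : α → ℝ≥0∞} {J : ℝ≥0∞} (hJ : J ≠ ∞)
    (h : ∀ δ : ℝ≥0, 0 < δ → ∀ᶠ r in l, q r ≤ (1 + δ : ℝ≥0) ^ 2 * J ∧
      J ≤ (1 + δ : ℝ≥0) ^ 2 * q r) : Tendsto q l (𝓝 J) := by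
  have hlim : ∀ a : ℝ≥0∞, a ≠ ∞ → Tendsto (fun δ : ℝ≥0 => ((1 + δ : ℝ≥0) : ℝ≥0∞) ^ 2 * a)
      (𝓝[>] 0) (𝓝 a) := fun a ha => by
    have h1 : Tendsto (fun δ : ℝ≥0 => (((1 + δ) ^ 2 : ℝ≥0) : ℝ≥0∞)) (𝓝[>] 0) (𝓝 1) := by
      have : Continuous fun δ : ℝ≥0 => (((1 + δ) ^ 2 : ℝ≥0) : ℝ≥0∞) := by
        exact ENNReal.continuous_coe.comp (by fun_prop)
      simpa using (this.tendsto 0).mono_left nhdsWithin_le_nhds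
    have h2 := ENNReal.Tendsto.mul_const (b := a) h1 (Or.inr ha)
    simpa using h2
  rw [tendsto_order]
  refine ⟨fun a ha => ?_, fun a ha => ?_⟩
  · obtain ⟨δ, h1, h2⟩ := (((hlim a (ha.trans_le le_top).ne).eventually_lt_const ha).and
      self_mem_nhdsWithin).exists
    filter_upwards [h δ h2] with r hr
    by_contra! hcon
    exact absurd (hr.2.trans (by gcongr)) (not_le.2 h1)
  · obtain ⟨δ, h1, h2⟩ := (((hlim J hJ).eventually_lt_const ha).and
      self_mem_nhdsWithin).exists
    filter_upwards [h δ h2] with r hr using hr.1.trans_lt h1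

namespace NormalFrame

variable (φ : NormalFrame)

/-- Strict differentiability bounds the difference between the increments of the graph map and of
its linearization by `δ ‖a - b‖`. Neither map shrinks distances, since horizontal projection undoes
both, so this error is at most `δ` times either increment. Each map is thus `(1 + δ)`-Lipschitz
relative to the other. -/
lemma eventually_measure_image_graphMap {h : Plane → ℝ} {h' : Plane →L[ℝ] ℝ} {y : Plane}
    (hh : HasStrictFDerivAt h h' y) {δ : ℝ≥0} (hδ : 0 < δ) :
    ∀ᶠ r in 𝓝[>] (0 : ℝ),
      Measure.euclideanHausdorffMeasure 2 (φ.graphMap h '' closedBall y r)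
        ≤ (1 + δ : ℝ≥0) ^ 2 * (ENNReal.ofReal √(1 + ‖h'‖ ^ 2) * volume (closedBall y r)) ∧
      ENNReal.ofReal √(1 + ‖h'‖ ^ 2) * volume (closedBall y r)
        ≤ (1 + δ : ℝ≥0) ^ 2 *
          Measure.euclideanHausdorffMeasure 2 (φ.graphMap h '' closedBall y r) := by
  have hs : HasStrictFDerivAt (φ.graphMap h) (φ.graphLin h') y :=
    φ.ι.toContinuousLinearMap.hasStrictFDerivAt.add (hh.smul_const φ.n)
  obtain ⟨s, hs1, hs2⟩ := hs.approximates_deriv_on_nhds (c := δ) (Or.inr hδ)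
  obtain ⟨ε, hε, hball⟩ := Metric.nhds_basis_closedBall.mem_iff.1 hs1
  filter_upwards [Ioc_mem_nhdsGT hε] with r hr
  have hsub : closedBall y r ⊆ s := (closedBall_subset_closedBall hr.2).trans hball
  have key : ∀ a ∈ closedBall y r, ∀ b ∈ closedBall y r,
      ‖φ.graphMap h a - φ.graphMap h b - φ.graphLin h' (a - b)‖ ≤ δ * ‖a - b‖ :=
    fun a ha b hb => hs2 a (hsub ha) b (hsub hb)
  simp only [← φ.measure_image_graphLin]
  constructor
  · refine euclideanHausdorffMeasure_image_le_image (fun a ha b hb => ?_) 2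
    rw [edist_dist, edist_dist, ← ENNReal.ofReal_coe_nnreal,
      ← ENNReal.ofReal_mul (NNReal.coe_nonneg _), dist_eq_norm, dist_eq_norm, ← map_sub]
    refine ENNReal.ofReal_le_ofReal ?_
    push_cast
    have h1 := norm_le_norm_add_norm_sub' (φ.graphMap h a - φ.graphMap h b) (φ.graphLin h' (a - b))
    have h2 := φ.norm_le_norm_graphLin h' (a - b)
    nlinarith [key a ha b hb, mul_le_mul_of_nonneg_left h2 δ.2]
  · refine euclideanHausdorffMeasure_image_le_image (fun a ha b hb => ?_) 2
    rw [edist_dist, edist_dist, ← ENNReal.ofReal_coe_nnreal,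
      ← ENNReal.ofReal_mul (NNReal.coe_nonneg _), dist_eq_norm, dist_eq_norm, ← map_sub]
    refine ENNReal.ofReal_le_ofReal ?_
    push_cast
    have h1 := norm_le_norm_add_norm_sub (φ.graphMap h a - φ.graphMap h b) (φ.graphLin h' (a - b))
    have h2 : ‖a - b‖ ≤ ‖φ.graphMap h a - φ.graphMap h b‖ := by
      simpa using φ.norm_L_le (φ.graphMap h a - φ.graphMap h b)
    nlinarith [key a ha b hb, mul_le_mul_of_nonneg_left h2 δ.2]

variable {h : Plane → ℝ} {V : Set Plane}

lemma measurableSet_image_graphMap (hV : IsOpen V) (hh : ContinuousOn h V) :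
    MeasurableSet (φ.graphMap h '' V) :=
  hV.measurableSet.image_of_continuousOn_injOn (φ.continuousOn_graphMap hh)
    (Function.LeftInverse.injective (φ.L_graphMap h)).injOn

lemma map_restrict_image_graphMap_apply (B : Set Plane) (hB : MeasurableSet B) :
    (((Measure.euclideanHausdorffMeasure 2 : Measure E3).restrict (φ.graphMap h '' V)).map φ.L) B
      = Measure.euclideanHausdorffMeasure 2 (φ.graphMap h '' (B ∩ V)) := by
  rw [Measure.map_apply φ.L.continuous.measurable hB,
    Measure.restrict_apply (φ.L.continuous.measurable hB)]
  congr 1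
  ext x
  constructor
  · rintro ⟨hx, y, hy, rfl⟩
    exact ⟨y, ⟨by simpa using hx, hy⟩, rfl⟩
  · rintro ⟨y, ⟨hyB, hy⟩, rfl⟩
    exact ⟨by simpa using hyB, y, hy, rfl⟩

lemma measure_image_graphMap_le {C : ℝ≥0} (hC : LipschitzOnWith C h V) (B : Set Plane) :
    Measure.euclideanHausdorffMeasure 2 (φ.graphMap h '' (B ∩ V))
      ≤ (1 + C : ℝ≥0) ^ 2 * volume (B ∩ V) := by
  have := euclideanHausdorffMeasure_image_le_image (f := φ.graphMap h) (g := fun y : Plane => y)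
    (s := B ∩ V) (C := 1 + C)
    (fun a ha b hb => φ.lipschitzOnWith_graphMap hC ha.2 hb.2) 2
  rwa [image_id', EuclideanSpace.euclideanHausdorffMeasure_eq_volume] at this

/-- The area formula for a `C¹` graph over a plane domain. -/
theorem map_restrict_image_graphMap (hV : IsOpen V) (hVfin : volume V ≠ ∞)
    (hh : ContDiffOn ℝ 1 h V) {C : ℝ≥0} (hC : LipschitzOnWith C h V) :
    ((Measure.euclideanHausdorffMeasure 2 : Measure E3).restrict (φ.graphMap h '' V)).map φ.L
      = (volume.restrict V).withDensity fun y => ENNReal.ofReal √(1 + ‖fderiv ℝ h y‖ ^ 2) := by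
  set ν := ((Measure.euclideanHausdorffMeasure 2 : Measure E3).restrict
    (φ.graphMap h '' V)).map φ.L with hν
  have happ : ∀ B, MeasurableSet B → ν B
      = Measure.euclideanHausdorffMeasure 2 (φ.graphMap h '' (B ∩ V)) := fun B hB =>
    φ.map_restrict_image_graphMap_apply B hB
  have hle : ∀ B, MeasurableSet B → ν B ≤ (1 + C : ℝ≥0) ^ 2 * volume (B ∩ V) := fun B hB =>
    (happ B hB).trans_le (φ.measure_image_graphMap_le hC B)
  have hfin : IsFiniteMeasure ν := ⟨(hle univ MeasurableSet.univ).trans_lt (by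
    rw [univ_inter]
    exact ENNReal.mul_lt_top (by finiteness) hVfin.lt_top)⟩
  have hac : ν ≪ volume := by
    refine Measure.AbsolutelyContinuous.mk fun B hB h0 => ?_
    refine le_antisymm ((hle B hB).trans ?_) zero_le
    rw [measure_mono_null inter_subset_left h0, mul_zero]
  have hνV : ν.restrict V = ν := by
    refine Measure.restrict_eq_self_of_ae_mem ?_
    rw [ae_iff]
    have := hle Vᶜ hV.measurableSet.compl
    rw [compl_inter_self, measure_empty, mul_zero] at this
    exact le_antisymm this zero_le
  have hder : ν.rnDeriv volume =ᵐ[volume.restrict V]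
      fun y => ENNReal.ofReal √(1 + ‖fderiv ℝ h y‖ ^ 2) := by
    -- By Besicovitch differentiation the density is almost everywhere the limit of measure ratios
    -- on shrinking balls, and the linear comparison determines that limit.
    rw [EventuallyEq, ae_restrict_iff' hV.measurableSet]
    filter_upwards [Besicovitch.ae_tendsto_rnDeriv ν (volume : Measure Plane)] with y hy hyV
    refine tendsto_nhds_unique hy (tendsto_of_forall_mul_le ENNReal.ofReal_ne_top fun δ hδ => ?_)
    have hstrict : HasStrictFDerivAt h (fderiv ℝ h y) y :=
      (hh.contDiffAt (hV.mem_nhds hyV)).hasStrictFDerivAt one_ne_zero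
    obtain ⟨ε, hε, hball⟩ := Metric.nhds_basis_closedBall.mem_iff.1 (hV.mem_nhds hyV)
    filter_upwards [φ.eventually_measure_image_graphMap hstrict hδ, Ioc_mem_nhdsGT hε]
      with r hr hrε
    have hsub : closedBall y r ∩ V = closedBall y r :=
      inter_eq_left.2 ((closedBall_subset_closedBall hrε.2).trans hball)
    have h0 : volume (closedBall y r) ≠ 0 := (measure_closedBall_pos _ _ hrε.1).ne'
    have ht : volume (closedBall y r) ≠ ∞ := measure_closedBall_lt_top.ne
    rw [happ _ measurableSet_closedBall, hsub]
    constructor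
    · rw [ENNReal.div_le_iff h0 ht, mul_assoc]
      exact hr.1
    · rw [← mul_div_assoc, ENNReal.le_div_iff_mul_le (Or.inl h0) (Or.inl ht)]
      exact hr.2
  calc ν = ν.restrict V := hνV.symm
    _ = (volume.withDensity (ν.rnDeriv volume)).restrict V := by
        rw [Measure.withDensity_rnDeriv_eq ν volume hac]
    _ = (volume.restrict V).withDensity (ν.rnDeriv volume) :=
        restrict_withDensity hV.measurableSet _
    _ = _ := withDensity_congr_ae hder

/-- Surface integrals over a `C¹` graph. -/
theorem setIntegral_image_graphMap (hV : IsOpen V) (hVfin : volume V ≠ ∞)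
    (hh : ContDiffOn ℝ 1 h V) {C : ℝ≥0} (hC : LipschitzOnWith C h V) {f : E3 → ℝ}
    (hf : ContinuousOn f (φ.graphMap h '' V)) :
    ∫ x in φ.graphMap h '' V, f x ∂(Measure.euclideanHausdorffMeasure 2)
      = ∫ y in V, √(1 + ‖fderiv ℝ h y‖ ^ 2) * f (φ.graphMap h y) := by
  have hm := φ.measurableSet_image_graphMap hV hh.continuousOn
  have h1 : ∫ x in φ.graphMap h '' V, f x ∂(Measure.euclideanHausdorffMeasure 2)
      = ∫ x in φ.graphMap h '' V, f (φ.graphMap h (φ.L x))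
        ∂(Measure.euclideanHausdorffMeasure 2) := by
    refine setIntegral_congr_fun hm ?_
    rintro _ ⟨y, -, rfl⟩
    simp
  have hcont : ContinuousOn (fun y => f (φ.graphMap h y)) V :=
    hf.comp (φ.continuousOn_graphMap hh.continuousOn) (mapsTo_image _ _)
  have hJ : ContinuousOn (fun y => √(1 + ‖fderiv ℝ h y‖ ^ 2)) V := by
    have := hh.continuousOn_fderiv_of_isOpen hV le_rfl
    fun_prop
  have hac : ((volume.restrict V).withDensity fun y => ENNReal.ofReal √(1 + ‖fderiv ℝ h y‖ ^ 2))
      ≪ volume.restrict V := withDensity_absolutelyContinuous _ _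
  have hmeas : AEStronglyMeasurable (fun y => f (φ.graphMap h y)) (volume.restrict V) :=
    hcont.aestronglyMeasurable hV.measurableSet
  rw [h1, ← integral_map (φ := φ.L) (f := fun y => f (φ.graphMap h y))
    φ.L.continuous.measurable.aemeasurable]
  · rw [φ.map_restrict_image_graphMap hV hVfin hh hC]
    rw [integral_withDensity_eq_integral_toReal_smul₀]
    · refine integral_congr_ae (Eventually.of_forall fun y => ?_)
      simp only [smul_eq_mul]
      rw [ENNReal.toReal_ofReal (Real.sqrt_nonneg _)]
    · exact (hJ.aemeasurable hV.measurableSet).ennreal_ofReal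
    · exact Eventually.of_forall fun y => ENNReal.ofReal_lt_top
  · rw [φ.map_restrict_image_graphMap hV hVfin hh hC]
    exact hmeas.mono_ac hac

end NormalFrame

end

/-! ### Local graph patches, the tangent plane and smoothness of the tangential projection. -/

section

open Metric Filter Topology
open scoped NNReal ENNReal RealInnerProductSpace

/-- A piece `Γ ∩ U` of `Γ` which is the graph of a `C²` function `h` over a plane domain `V`. -/
structure GraphPatch (Γ : Set E3) where
  frame : NormalFrame
  h : Plane → ℝ
  V : Set Plane
  U : Set E3
  C : ℝ≥0
  isOpen_V : IsOpen V
  isOpen_U : IsOpen U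
  volume_V : volume V ≠ ∞
  contDiffOn_h : ContDiffOn ℝ 2 h V
  lipschitz : LipschitzOnWith C h V
  mapsTo_L : MapsTo frame.L U V
  inter_eq : Γ ∩ U = frame.graphMap h '' V

/-- The implicit function theorem in coordinates whose vertical axis is the gradient direction of
the local equation at `p`; the vertical partial derivative there is the norm of the gradient, hence
invertible. -/
theorem IsClosedSurface.exists_graphPatch {Γ : Set E3} (hΓ : IsClosedSurface Γ) {p : E3}
    (hp : p ∈ Γ) : ∃ P : GraphPatch Γ, p ∈ P.U := by
  obtain ⟨U₀, F, hU₀, hpU₀, hF, hdF, hΓU⟩ := hΓ.exists_local_equation p hp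
  set g : E3 := (InnerProductSpace.toDual ℝ E3).symm (fderiv ℝ F p) with hg
  have hg_inner : ∀ z, fderiv ℝ F p z = ⟪g, z⟫ := fun z =>
    (InnerProductSpace.toDual_symm_apply).symm
  have hg0 : g ≠ 0 := by
    simpa [hg] using hdF p hpU₀
  have hgn : ‖g‖ ≠ 0 := norm_ne_zero_iff.2 hg0
  obtain ⟨φ, hφ⟩ := NormalFrame.exists_of_norm_eq_one (n := ‖g‖⁻¹ • g)
    (by rw [norm_smul, norm_inv, norm_norm, inv_mul_cancel₀ hgn])
  let A : Plane × ℝ →L[ℝ] E3 := (φ.ι.toContinuousLinearMap).coprod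
    ((ContinuousLinearMap.id ℝ ℝ).smulRight φ.n)
  have hA : ∀ v, A v = φ.ι v.1 + v.2 • φ.n := fun v => by simp [A]
  set w : Plane × ℝ := (φ.L p, ⟪φ.n, p⟫) with hw
  have hAw : A w = p := by rw [hA]; exact φ.decomp p
  let f : Plane × ℝ → ℝ := fun v => F (A v)
  have hFp : ContDiffAt ℝ 2 F (A w) := by
    rw [hAw]; exact hF.contDiffAt (hU₀.mem_nhds hpU₀)
  have cdf : ContDiffAt ℝ 2 f w := hFp.comp w A.contDiff.contDiffAt
  have hfw : f w = 0 := by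
    have : p ∈ {x ∈ U₀ | F x = 0} := hΓU ▸ ⟨hp, hpU₀⟩
    simp only [f, hAw]; exact this.2
  have hfd : fderiv ℝ f w = fderiv ℝ F p ∘L A := by
    have := (hFp.differentiableAt two_ne_zero).hasFDerivAt.comp w A.hasFDerivAt
    rw [hAw] at this
    exact this.fderiv
  have hinv : (fderiv ℝ f w ∘L .inr ℝ Plane ℝ).IsInvertible := by
    have happ : ∀ c : ℝ, (fderiv ℝ f w ∘L .inr ℝ Plane ℝ) c = c * ‖g‖ := fun c => by
      rw [hfd]
      simp only [ContinuousLinearMap.comp_apply, ContinuousLinearMap.inr_apply, hA, map_zero,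
        zero_add, hg_inner, hφ, inner_smul_right, real_inner_self_eq_norm_sq]
      field_simp
    refine ContinuousLinearMap.IsInvertible.of_inverse (g := ‖g‖⁻¹ • ContinuousLinearMap.id ℝ ℝ)
      ?_ ?_ <;>
    · ext
      simp only [ContinuousLinearMap.comp_apply, happ]
      simp [hgn]
  set h := cdf.implicitFunction two_ne_zero hinv with hh
  have hhw : h w.1 = w.2 := cdf.implicitFunction_apply_self two_ne_zero hinv
  have hiff := cdf.eventually_apply_eq_iff_implicitFunction two_ne_zero hinv
  have hcd : ContDiffAt ℝ 2 h w.1 := cdf.contDiffAt_implicitFunction two_ne_zero hinv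
  have hU₀' : ∀ᶠ v in 𝓝 w, A v ∈ U₀ :=
    A.continuous.continuousAt.eventually_mem (by rw [hAw]; exact hU₀.mem_nhds hpU₀)
  have hev : ∀ᶠ v in 𝓝 w.1 ×ˢ 𝓝 w.2, (f v = f w ↔ h v.1 = v.2) ∧ A v ∈ U₀ := by
    rw [← nhds_prod_eq]
    exact hiff.and hU₀'
  obtain ⟨pa, hpa, pb, hpb, hab⟩ := eventually_prod_iff.1 hev
  obtain ⟨I, hIsub, hIo, hwI⟩ := _root_.mem_nhds_iff.1 hpb
  obtain ⟨C, t, ht, hC⟩ := (hcd.of_le one_le_two).exists_lipschitzOnWith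
  have hIh : ∀ᶠ y in 𝓝 w.1, h y ∈ I :=
    hcd.continuousAt.eventually_mem (by rw [hhw]; exact hIo.mem_nhds hwI)
  have hall : ∀ᶠ y in 𝓝 w.1, pa y ∧ h y ∈ I ∧ y ∈ t ∧ ContDiffAt ℝ 2 h y :=
    hpa.and (hIh.and (Filter.Eventually.and ht (hcd.eventually (by simp))))
  obtain ⟨r, hr, hball⟩ := Metric.eventually_nhds_iff_ball.1 hall
  -- The neighbourhood is a vertical box, ball times `I`. The radius is small enough that `h` maps
  -- the ball into `I`, so the whole graph over the ball stays in the box.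
  refine ⟨⟨φ, h, ball w.1 r, {x | φ.L x ∈ ball w.1 r ∧ ⟪φ.n, x⟫ ∈ I}, C, isOpen_ball,
    (isOpen_ball.preimage φ.L.continuous).inter (hIo.preimage (by fun_prop)),
    measure_ball_lt_top.ne, fun y hy => (hball y hy).2.2.2.contDiffWithinAt,
    hC.mono fun y hy => (hball y hy).2.2.1, fun x hx => hx.1, ?_⟩,
    mem_ball_self hr, hwI⟩
  have hrec : ∀ x, A (φ.L x, ⟪φ.n, x⟫) = x := fun x => by rw [hA]; exact φ.decomp x
  ext x
  constructor
  · rintro ⟨hxΓ, hxL, hxI⟩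
    have h1 := hab (hball _ hxL).1 (hIsub hxI)
    rw [hrec] at h1
    have h2 : x ∈ {x ∈ U₀ | F x = 0} := hΓU ▸ ⟨hxΓ, h1.2⟩
    have h3 : h (φ.L x) = ⟪φ.n, x⟫ := h1.1.1 (by
      change F (A (φ.L x, ⟪φ.n, x⟫)) = f w
      rw [hrec, hfw]; exact h2.2)
    refine ⟨φ.L x, hxL, ?_⟩
    rw [NormalFrame.graphMap, h3, φ.decomp]
  · rintro ⟨y, hy, rfl⟩
    have hyI := (hball y hy).2.1
    have h1 := hab (hball _ hy).1 (hIsub hyI)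
    have hAy : A (y, h y) = φ.graphMap h y := by rw [hA]; rfl
    rw [hAy] at h1
    have h2 : F (φ.graphMap h y) = 0 := by
      have := h1.1.2 rfl
      rw [hfw] at this
      rw [← hAy]; exact this
    have h3 : φ.graphMap h y ∈ Γ ∩ U₀ := hΓU ▸ ⟨h1.2, h2⟩
    exact ⟨h3.1, by simpa using hy, by simpa using hyI⟩

namespace GraphPatch

variable {Γ : Set E3} (P : GraphPatch Γ)

/-- The parametrization of the patch. -/
def ψ : Plane → E3 := P.frame.graphMap P.h

lemma contDiffAt_h {y : Plane} (hy : y ∈ P.V) : ContDiffAt ℝ 2 P.h y :=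
  P.contDiffOn_h.contDiffAt (P.isOpen_V.mem_nhds hy)

lemma hasFDerivAt_h {y : Plane} (hy : y ∈ P.V) : HasFDerivAt P.h (fderiv ℝ P.h y) y :=
  ((P.contDiffAt_h hy).differentiableAt two_ne_zero).hasFDerivAt

lemma contDiffOn_fderiv_h : ContDiffOn ℝ 1 (fderiv ℝ P.h) P.V :=
  P.contDiffOn_h.fderiv_of_isOpen P.isOpen_V (by norm_num)

lemma ψ_mem {y : Plane} (hy : y ∈ P.V) : P.ψ y ∈ Γ ∩ P.U := by
  rw [P.inter_eq]; exact mem_image_of_mem _ hy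

@[simp] lemma L_ψ (y : Plane) : P.frame.L (P.ψ y) = y := P.frame.L_graphMap _ _

lemma ψ_L {x : E3} (hx : x ∈ Γ ∩ P.U) : P.ψ (P.frame.L x) = x := by
  rw [P.inter_eq] at hx
  obtain ⟨y, -, rfl⟩ := hx
  rw [P.frame.L_graphMap]; rfl

lemma hasFDerivAt_ψ {y : Plane} (hy : y ∈ P.V) :
    HasFDerivAt P.ψ (P.frame.graphLin (fderiv ℝ P.h y)) y :=
  P.frame.hasFDerivAt_graphMap (P.hasFDerivAt_h hy)

lemma continuousOn_ψ : ContinuousOn P.ψ P.V :=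
  P.frame.continuousOn_graphMap P.contDiffOn_h.continuousOn

lemma contDiffOn_ψ : ContDiffOn ℝ 2 P.ψ P.V :=
  P.frame.ι.toContinuousLinearMap.contDiff.contDiffOn.add
    (P.contDiffOn_h.smul contDiffOn_const)

/-- The upward normal `n - ι ∇h`, of length `√(1 + |∇h|²)`, at the point above `y`. -/
def normal (y : Plane) : E3 := P.frame.n - P.frame.ι (gradient P.h y)

lemma inner_normal (y : Plane) (v : E3) :
    ⟪P.normal y, v⟫ = ⟪P.frame.n, v⟫ - fderiv ℝ P.h y (P.frame.L v) := by
  rw [normal, inner_sub_left, P.frame.inner_ι_left, gradient, InnerProductSpace.toDual_symm_apply]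

lemma inner_normal_self (y : Plane) : ⟪P.normal y, P.normal y⟫ = 1 + ‖fderiv ℝ P.h y‖ ^ 2 := by
  have h1 : P.frame.L (P.normal y) = - gradient P.h y := by simp [normal]
  have h2 : ⟪P.frame.n, P.normal y⟫ = (1 : ℝ) := by
    rw [normal, inner_sub_right, P.frame.inner_ι, P.frame.inner_self_n, sub_zero]
  have h3 : ‖gradient P.h y‖ = ‖fderiv ℝ P.h y‖ := by simp [gradient]
  rw [real_inner_self_eq_norm_sq, P.frame.norm_sq_eq, h1, h2, norm_neg, h3]
  ring

lemma inner_normal_self_pos (y : Plane) : 0 < (⟪P.normal y, P.normal y⟫ : ℝ) := by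
  rw [inner_normal_self]; positivity

lemma mem_nhdsWithin_U {x : E3} (hx : x ∈ P.U) : Γ ∩ P.U ∈ 𝓝[Γ] x :=
  inter_mem_nhdsWithin Γ (P.isOpen_U.mem_nhds hx)

/-- The tangent plane is the orthogonal complement of the normal. -/
lemma tangentPlane_eq {x : E3} (hx : x ∈ Γ ∩ P.U) :
    tangentPlane Γ x = (ℝ ∙ P.normal (P.frame.L x))ᗮ := by
  set y := P.frame.L x with hy
  have hyV : y ∈ P.V := P.mapsTo_L hx.2
  have hψ : P.ψ y = x := P.ψ_L hx
  apply le_antisymm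
  · rw [tangentPlane, Submodule.span_le]
    intro v hv
    rw [SetLike.mem_coe, Submodule.mem_orthogonal_singleton_iff_inner_right, P.inner_normal]
    -- This function vanishes on `Γ` near `x`, so its derivative agrees with zero on the tangent
    -- cone.
    have h1 : HasFDerivWithinAt (fun z => ⟪P.frame.n, z⟫ - P.h (P.frame.L z))
        (innerSL ℝ P.frame.n - fderiv ℝ P.h y ∘L P.frame.L) Γ x :=
      ((innerSL ℝ P.frame.n).hasFDerivAt.sub
        ((P.hasFDerivAt_h hyV).comp x P.frame.L.hasFDerivAt)).hasFDerivWithinAt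
    have h2 : HasFDerivWithinAt (fun z => ⟪P.frame.n, z⟫ - P.h (P.frame.L z))
        (0 : E3 →L[ℝ] ℝ) Γ x := by
      refine (EventuallyEq.hasFDerivWithinAt_iff_of_mem ?_ hx.1).2
        (hasFDerivWithinAt_const (0 : ℝ) x Γ)
      filter_upwards [P.mem_nhdsWithin_U hx.2] with z hz
      conv_lhs => rw [← P.ψ_L hz]
      simp [ψ]
    exact h1.unique_on h2 hv
  · intro v hv
    rw [Submodule.mem_orthogonal_singleton_iff_inner_right, P.inner_normal, sub_eq_zero] at hv
    apply Submodule.subset_span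
    -- Conversely, the tangent cone of the open set `V` is everything, and the derivative of the
    -- parametrization carries it into the tangent cone of `Γ`.
    have h1 := (P.hasFDerivAt_ψ hyV).hasFDerivWithinAt (s := P.V)
    have hvV : P.frame.L v ∈ tangentConeAt ℝ P.V y := by
      rw [tangentConeAt_of_mem_nhds (P.isOpen_V.mem_nhds hyV)]; trivial
    have h2 := h1.mapsTo_tangent_cone hvV
    have h3 : P.frame.graphLin (fderiv ℝ P.h y) (P.frame.L v) = v := by
      rw [P.frame.graphLin_apply, ← hv, P.frame.decomp]
    rw [h3, hψ] at h2
    exact tangentConeAt_mono (by rintro _ ⟨z, hz, rfl⟩; exact (P.ψ_mem hz).1) h2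

lemma tangentProj_apply {x : E3} (hx : x ∈ Γ ∩ P.U) (v : E3) :
    tangentProj Γ x v = v - (⟪P.normal (P.frame.L x), v⟫ /
      ⟪P.normal (P.frame.L x), P.normal (P.frame.L x)⟫) • P.normal (P.frame.L x) := by
  rw [tangentProj]
  have h := P.tangentPlane_eq hx
  have h1 : (tangentPlane Γ x).starProjection v
      = ((ℝ ∙ P.normal (P.frame.L x))ᗮ).starProjection v := by
    simp only [h]
  rw [h1, Submodule.starProjection_orthogonal', sub_apply, one_apply_eq_self,
    Submodule.starProjection_singleton,
    real_inner_self_eq_norm_sq]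
  simp

lemma contDiffOn_normal : ContDiffOn ℝ 1 (fun x => P.normal (P.frame.L x)) P.U := by
  have h1 : ContDiffOn ℝ 1 (gradient P.h) P.V := by
    exact ((InnerProductSpace.toDual ℝ Plane).symm.toContinuousLinearEquiv
      |>.contDiff.comp_contDiffOn P.contDiffOn_fderiv_h)
  exact contDiffOn_const.sub (P.frame.ι.toContinuousLinearMap.contDiff.comp_contDiffOn
    (h1.comp P.frame.L.contDiff.contDiffOn P.mapsTo_L))

/-- The normal involves `∇h`, so one derivative is lost from `C²`; the explicit formula for the
projection divides only by `|N|² ≥ 1`. -/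
lemma contDiffOn_tangentProj : ContDiffOn ℝ 1 (tangentProj Γ) (Γ ∩ P.U) := by
  have hN := P.contDiffOn_normal.mono (inter_subset_right (s := Γ))
  rw [contDiffOn_clm_apply]
  intro v
  refine ContDiffOn.congr (contDiffOn_const.sub
    (ContDiffOn.smul ((hN.inner ℝ contDiffOn_const).div (hN.inner ℝ hN) ?_) hN))
    (fun x hx => P.tangentProj_apply hx v)
  exact fun x _ => (P.inner_normal_self_pos _).ne'

end GraphPatch

/-- The tangential projection of a closed `C²` surface is `C¹`. -/
theorem IsClosedSurface.contDiffOn_tangentProj {Γ : Set E3} (hΓ : IsClosedSurface Γ) :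
    ContDiffOn ℝ 1 (tangentProj Γ) Γ := by
  intro x hx
  obtain ⟨P, hP⟩ := hΓ.exists_graphPatch hx
  exact (P.contDiffOn_tangentProj x ⟨hx, hP⟩).mono_of_mem_nhdsWithin (P.mem_nhdsWithin_U hP)

end

/-! ### Tangential calculus on `Γ` and on space-time. -/

section

open Metric Filter Topology
open scoped NNReal ENNReal RealInnerProductSpace

section Calculus

variable {Γ : Set E3} {x : E3}

lemma tangentProj_mem (v : E3) : tangentProj Γ x v ∈ tangentPlane Γ x :=
  Submodule.starProjection_apply_mem _ v

lemma tangentProj_eq_self {v : E3} (hv : v ∈ tangentPlane Γ x) : tangentProj Γ x v = v :=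
  Submodule.starProjection_eq_self_iff.2 hv

lemma inner_tangentProj_left (v w : E3) : ⟪tangentProj Γ x v, w⟫ = ⟪v, tangentProj Γ x w⟫ :=
  Submodule.inner_starProjection_left_eq_right _ v w

/-- Derivatives within `Γ` are not unique in normal directions. Agreement on the tangent plane is
what makes the surface operators independent of the derivative chosen. -/
lemma eqOn_tangentPlane {G : Type*} [NormedAddCommGroup G] [NormedSpace ℝ G] {f : E3 → G}
    {A B : E3 →L[ℝ] G} (hA : HasFDerivWithinAt f A Γ x) (hB : HasFDerivWithinAt f B Γ x) {v : E3}
    (hv : v ∈ tangentPlane Γ x) : A v = B v :=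
  LinearMap.eqOn_span (f := (A : E3 →ₗ[ℝ] G)) (g := (B : E3 →ₗ[ℝ] G)) (hA.unique_on hB) hv

/-- The trace as a continuous linear functional. -/
def traceCLM : (E3 →L[ℝ] E3) →L[ℝ] ℝ :=
  LinearMap.toContinuousLinearMap (LinearMap.trace ℝ E3 ∘ₗ ContinuousLinearMap.coeLM ℝ)

lemma traceCLM_apply (A : E3 →L[ℝ] E3) : traceCLM A = LinearMap.trace ℝ E3 (A : E3 →ₗ[ℝ] E3) := rfl

/-- The tangential divergence may be computed with any derivative along `Γ`. -/
lemma surfaceDiv_eq {F : E3 → E3} {A : E3 →L[ℝ] E3} (hA : HasFDerivWithinAt F A Γ x) :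
    surfaceDiv Γ F x = traceCLM (A ∘L tangentProj Γ x) := by
  have h : fderivWithin ℝ F Γ x ∘L tangentProj Γ x = A ∘L tangentProj Γ x := by
    ext1 v
    exact eqOn_tangentPlane hA.differentiableWithinAt.hasFDerivWithinAt hA (tangentProj_mem v)
  rw [surfaceDiv, h, traceCLM_apply]

/-- The tangential gradient may be computed with any derivative along `Γ`. -/
lemma surfaceGrad_eq {f : E3 → ℝ} {a : E3 →L[ℝ] ℝ} (ha : HasFDerivWithinAt f a Γ x) :
    surfaceGrad Γ f x = tangentProj Γ x ((InnerProductSpace.toDual ℝ E3).symm a) := by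
  refine ext_inner_right ℝ fun w => ?_
  rw [surfaceGrad, inner_tangentProj_left, inner_tangentProj_left, gradientWithin,
    InnerProductSpace.toDual_symm_apply, InnerProductSpace.toDual_symm_apply]
  exact eqOn_tangentPlane ha.differentiableWithinAt.hasFDerivWithinAt ha (tangentProj_mem w)

lemma surfaceGrad_mem (f : E3 → ℝ) : surfaceGrad Γ f x ∈ tangentPlane Γ x := tangentProj_mem _

lemma inner_surfaceGrad {f : E3 → ℝ} {a : E3 →L[ℝ] ℝ} (ha : HasFDerivWithinAt f a Γ x) {w : E3}
    (hw : w ∈ tangentPlane Γ x) : ⟪surfaceGrad Γ f x, w⟫ = a w := by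
  rw [surfaceGrad_eq ha, inner_tangentProj_left, tangentProj_eq_self hw,
    InnerProductSpace.toDual_symm_apply]

lemma surfaceDiv_add {F G : E3 → E3} (hF : DifferentiableWithinAt ℝ F Γ x)
    (hG : DifferentiableWithinAt ℝ G Γ x) :
    surfaceDiv Γ (fun y => F y + G y) x = surfaceDiv Γ F x + surfaceDiv Γ G x := by
  rw [surfaceDiv_eq (hF.hasFDerivWithinAt.fun_add hG.hasFDerivWithinAt),
    surfaceDiv_eq hF.hasFDerivWithinAt, surfaceDiv_eq hG.hasFDerivWithinAt,
    ContinuousLinearMap.add_comp, map_add]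

lemma surfaceDiv_const_smul {F : E3 → E3} (hF : DifferentiableWithinAt ℝ F Γ x) (c : ℝ) :
    surfaceDiv Γ (fun y => c • F y) x = c * surfaceDiv Γ F x := by
  rw [surfaceDiv_eq (hF.hasFDerivWithinAt.fun_const_smul c), surfaceDiv_eq hF.hasFDerivWithinAt,
    ContinuousLinearMap.smul_comp, map_smul, smul_eq_mul]

lemma surfaceDiv_sum {ι : Type*} (s : Finset ι) {F : ι → E3 → E3}
    (hF : ∀ i ∈ s, DifferentiableWithinAt ℝ (F i) Γ x) :
    surfaceDiv Γ (fun y => ∑ i ∈ s, F i y) x = ∑ i ∈ s, surfaceDiv Γ (F i) x := by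
  rw [surfaceDiv_eq (HasFDerivWithinAt.fun_sum fun i hi => (hF i hi).hasFDerivWithinAt),
    Finset.sum_congr rfl fun i hi => surfaceDiv_eq (hF i hi).hasFDerivWithinAt, ← map_sum]
  congr 1
  ext1 v
  simp

lemma surfaceDiv_congr {F G : E3 → E3} (h : EqOn F G Γ) (hx : x ∈ Γ) :
    surfaceDiv Γ F x = surfaceDiv Γ G x := by
  rw [surfaceDiv, surfaceDiv, fderivWithin_congr h (h hx)]

/-- The product rule `div_Γ (f W) = f div_Γ W + ∇_Γ f · W` for tangential `W`. -/
lemma surfaceDiv_smul {f : E3 → ℝ} {W : E3 → E3} (hf : DifferentiableWithinAt ℝ f Γ x)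
    (hW : DifferentiableWithinAt ℝ W Γ x) (hWx : W x ∈ tangentPlane Γ x) :
    surfaceDiv Γ (fun y => f y • W y) x
      = f x * surfaceDiv Γ W x + ⟪surfaceGrad Γ f x, W x⟫ := by
  rw [surfaceDiv_eq (hf.hasFDerivWithinAt.fun_smul hW.hasFDerivWithinAt),
    surfaceDiv_eq hW.hasFDerivWithinAt, ContinuousLinearMap.add_comp, map_add,
    ContinuousLinearMap.smul_comp, map_smul, smul_eq_mul,
    inner_surfaceGrad hf.hasFDerivWithinAt hWx]
  congr 1
  have : ((ContinuousLinearMap.smulRight (fderivWithin ℝ f Γ x) (W x) ∘L tangentProj Γ x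
      : E3 →L[ℝ] E3) : E3 →ₗ[ℝ] E3)
      = LinearMap.smulRight ((fderivWithin ℝ f Γ x ∘L tangentProj Γ x : E3 →L[ℝ] ℝ) :
        E3 →ₗ[ℝ] ℝ) (W x) := by
    ext1 v; rfl
  rw [traceCLM_apply, this, LinearMap.trace_smulRight]
  simp [tangentProj_eq_self hWx]

end Calculus

section SpaceTime

variable {Γ : Set E3} {G : Type*} [NormedAddCommGroup G] [NormedSpace ℝ G]

/-- Space-time `[0, 1] × Γ`. -/
abbrev cylinder (Γ : Set E3) : Set (ℝ × E3) := Icc 0 1 ×ˢ Γ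

/-- Without unique differentiability of `s`, `fderivWithin` is an arbitrary choice and need not be
continuous. A locally chosen derivative, continuous at the point, suffices for continuity of the
tangential operators, which do not depend on the choice. -/
lemma _root_.ContDiffOn.exists_hasFDerivWithinAt_near {E : Type*} [NormedAddCommGroup E]
    [NormedSpace ℝ E] {s : Set E} {f : E → G} (hf : ContDiffOn ℝ 1 f s) {z : E} (hz : z ∈ s) :
    ∃ f' : E → E →L[ℝ] G, (∀ᶠ w in 𝓝[s] z, HasFDerivWithinAt f (f' w) s w) ∧
      ContinuousWithinAt f' s z := by
  have h := hf z hz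
  rw [← zero_add 1, contDiffWithinAt_succ_iff_hasFDerivWithinAt' (by simp)] at h
  obtain ⟨u, hu, -, -, f', h1, h2⟩ := h
  rw [insert_eq_of_mem hz] at hu
  exact ⟨f', Filter.mem_of_superset hu h1, h2.continuousWithinAt⟩

lemma hasFDerivWithinAt_space {f : ℝ → E3 → G} {A : ℝ × E3 →L[ℝ] G} {z : ℝ × E3}
    (hz : z ∈ cylinder Γ)
    (hA : HasFDerivWithinAt (fun z : ℝ × E3 => f z.1 z.2) A (cylinder Γ) z) :
    HasFDerivWithinAt (f z.1) (A ∘L .inr ℝ ℝ E3) Γ z.2 :=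
  HasFDerivWithinAt.comp (f := fun y => (z.1, y)) z.2 hA
    (hasFDerivAt_prodMk_right z.1 z.2).hasFDerivWithinAt fun _ hy => ⟨hz.1, hy⟩

lemma hasDerivWithinAt_time {f : ℝ → E3 → G} {A : ℝ × E3 →L[ℝ] G} {z : ℝ × E3}
    (hz : z ∈ cylinder Γ)
    (hA : HasFDerivWithinAt (fun z : ℝ × E3 => f z.1 z.2) A (cylinder Γ) z) :
    HasDerivWithinAt (fun s => f s z.2) (A (1, 0)) (Icc 0 1) z.1 := by
  have := HasFDerivWithinAt.comp (f := fun s => (s, z.2)) z.1 hA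
    (hasFDerivAt_prodMk_left z.1 z.2).hasFDerivWithinAt
    (show MapsTo (fun s => (s, z.2)) (Icc (0 : ℝ) 1) (cylinder Γ) from fun _ hs => ⟨hs, hz.2⟩)
  exact this.hasDerivWithinAt

lemma timeDeriv_eq {f : ℝ → E3 → ℝ} {a t : ℝ} {x : E3} (ht : t ∈ Icc (0 : ℝ) 1)
    (h : HasDerivWithinAt (fun s => f s x) a (Icc 0 1) t) : timeDeriv f t x = a :=
  h.derivWithin (uniqueDiffOn_Icc zero_lt_one t ht)

lemma differentiableWithinAt_space {f : ℝ → E3 → G}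
    (hf : ContDiffOn ℝ 1 (fun z : ℝ × E3 => f z.1 z.2) (cylinder Γ)) {z : ℝ × E3}
    (hz : z ∈ cylinder Γ) : DifferentiableWithinAt ℝ (f z.1) Γ z.2 :=
  (hasFDerivWithinAt_space hz ((hf.differentiableOn one_ne_zero) z hz).hasFDerivWithinAt)
    |>.differentiableWithinAt

lemma hasDerivWithinAt_timeDeriv {f : ℝ → E3 → ℝ}
    (hf : ContDiffOn ℝ 1 (fun z : ℝ × E3 => f z.1 z.2) (cylinder Γ)) {z : ℝ × E3}
    (hz : z ∈ cylinder Γ) :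
    HasDerivWithinAt (fun s => f s z.2) (timeDeriv f z.1 z.2) (Icc 0 1) z.1 :=
  (hasDerivWithinAt_time hz ((hf.differentiableOn one_ne_zero) z hz).hasFDerivWithinAt)
    |>.differentiableWithinAt.hasDerivWithinAt

lemma contDiffOn_space {f : ℝ → E3 → G}
    (hf : ContDiffOn ℝ 1 (fun z : ℝ × E3 => f z.1 z.2) (cylinder Γ)) {t : ℝ}
    (ht : t ∈ Icc (0 : ℝ) 1) : ContDiffOn ℝ 1 (f t) Γ :=
  hf.comp (f := fun y => (t, y)) (contDiffOn_const.prodMk contDiffOn_id) fun _ hy => ⟨ht, hy⟩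

lemma continuousOn_timeDeriv {f : ℝ → E3 → ℝ}
    (hf : ContDiffOn ℝ 1 (fun z : ℝ × E3 => f z.1 z.2) (cylinder Γ)) :
    ContinuousOn (fun z : ℝ × E3 => timeDeriv f z.1 z.2) (cylinder Γ) := by
  intro z hz
  obtain ⟨f', h1, h2⟩ := hf.exists_hasFDerivWithinAt_near hz
  have h3 : ContinuousWithinAt (fun w => f' w (1, 0)) (cylinder Γ) z :=
    h2.clm_apply continuousWithinAt_const
  refine h3.congr_of_eventuallyEq_of_mem ?_ hz
  filter_upwards [h1, self_mem_nhdsWithin] with w hw hwK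
  exact timeDeriv_eq hwK.1 (hasDerivWithinAt_time hwK hw)

lemma continuousWithinAt_tangentProj (hΓ : IsClosedSurface Γ) {z : ℝ × E3} (hz : z ∈ cylinder Γ) :
    ContinuousWithinAt (fun w : ℝ × E3 => tangentProj Γ w.2) (cylinder Γ) z :=
  (hΓ.contDiffOn_tangentProj.continuousOn z.2 hz.2).comp continuous_snd.continuousWithinAt
    fun _ hw => hw.2

lemma continuousOn_surfaceGrad (hΓ : IsClosedSurface Γ) {f : ℝ → E3 → ℝ}
    (hf : ContDiffOn ℝ 1 (fun z : ℝ × E3 => f z.1 z.2) (cylinder Γ)) :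
    ContinuousOn (fun z : ℝ × E3 => surfaceGrad Γ (f z.1) z.2) (cylinder Γ) := by
  intro z hz
  obtain ⟨f', h1, h2⟩ := hf.exists_hasFDerivWithinAt_near hz
  have h3 : ContinuousWithinAt (fun w => tangentProj Γ w.2
      ((InnerProductSpace.toDual ℝ E3).symm (f' w ∘L .inr ℝ ℝ E3))) (cylinder Γ) z :=
    (continuousWithinAt_tangentProj hΓ hz).clm_apply
      ((InnerProductSpace.toDual ℝ E3).symm.continuous.continuousAt.comp_continuousWithinAt
        (h2.clm_comp continuousWithinAt_const))
  refine h3.congr_of_eventuallyEq_of_mem ?_ hz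
  filter_upwards [h1, self_mem_nhdsWithin] with w hw hwK
  exact surfaceGrad_eq (hasFDerivWithinAt_space hwK hw)

lemma continuousOn_surfaceDiv (hΓ : IsClosedSurface Γ) {F : ℝ → E3 → E3}
    (hF : ContDiffOn ℝ 1 (fun z : ℝ × E3 => F z.1 z.2) (cylinder Γ)) :
    ContinuousOn (fun z : ℝ × E3 => surfaceDiv Γ (F z.1) z.2) (cylinder Γ) := by
  intro z hz
  obtain ⟨f', h1, h2⟩ := hF.exists_hasFDerivWithinAt_near hz
  have h3 : ContinuousWithinAt (fun w => traceCLM ((f' w ∘L .inr ℝ ℝ E3) ∘L tangentProj Γ w.2))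
      (cylinder Γ) z :=
    traceCLM.continuous.continuousAt.comp_continuousWithinAt
      ((h2.clm_comp continuousWithinAt_const).clm_comp (continuousWithinAt_tangentProj hΓ hz))
  refine h3.congr_of_eventuallyEq_of_mem ?_ hz
  filter_upwards [h1, self_mem_nhdsWithin] with w hw hwK
  exact surfaceDiv_eq (hasFDerivWithinAt_space hwK hw)

/-- The time-independent version of `continuousOn_surfaceDiv`. -/
lemma continuousOn_surfaceDiv_space (hΓ : IsClosedSurface Γ) {W : E3 → E3}
    (hW : ContDiffOn ℝ 1 W Γ) : ContinuousOn (surfaceDiv Γ W) Γ := by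
  have h : ContDiffOn ℝ 1 (fun z : ℝ × E3 => W z.2) (cylinder Γ) :=
    hW.comp contDiffOn_snd fun z hz => hz.2
  have h1 := continuousOn_surfaceDiv (F := fun _ => W) hΓ h
  exact h1.comp (f := fun x => ((0 : ℝ), x)) (by fun_prop) fun x hx => ⟨by simp, hx⟩

end SpaceTime

end

/-! ### Area measure and the divergence theorem on a closed surface. -/

section

open Metric Filter Topology
open scoped NNReal ENNReal RealInnerProductSpace Manifold ContDiff

section SurfaceMeasure

variable {Γ : Set E3}

lemma GraphPatch.measure_inter_lt_top (P : GraphPatch Γ) :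
    Measure.euclideanHausdorffMeasure 2 (Γ ∩ P.U) < ⊤ := by
  have h := P.frame.measure_image_graphMap_le P.lipschitz univ
  rw [univ_inter, ← P.inter_eq] at h
  exact h.trans_lt (ENNReal.mul_lt_top (by finiteness) P.volume_V.lt_top)

theorem IsClosedSurface.isFiniteMeasure (hΓ : IsClosedSurface Γ) :
    IsFiniteMeasure (surfaceMeasure Γ) := by
  refine ⟨?_⟩
  rw [surfaceMeasure, Measure.restrict_apply_univ]
  refine hΓ.isCompact.measure_lt_top_of_nhdsWithin fun x hx => ?_
  obtain ⟨P, hP⟩ := hΓ.exists_graphPatch hx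
  exact ⟨Γ ∩ P.U, P.mem_nhdsWithin_U hP, P.measure_inter_lt_top⟩

/-- Horizontal projection is 1-Lipschitz, so the area of a piece of graph is at least the Lebesgue
measure of its shadow, which is open and nonempty. -/
theorem IsClosedSurface.measure_pos_of_isOpen (hΓ : IsClosedSurface Γ) {O : Set E3}
    (hO : IsOpen O) {x : E3} (hxΓ : x ∈ Γ) (hxO : x ∈ O) : 0 < surfaceMeasure Γ O := by
  obtain ⟨P, hP⟩ := hΓ.exists_graphPatch hxΓ
  rw [surfaceMeasure, Measure.restrict_apply hO.measurableSet]
  have hopen : IsOpen (P.V ∩ P.ψ ⁻¹' O) := P.continuousOn_ψ.isOpen_inter_preimage P.isOpen_V hO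
  have hne : (P.V ∩ P.ψ ⁻¹' O).Nonempty :=
    ⟨P.frame.L x, P.mapsTo_L hP, by rw [mem_preimage, P.ψ_L ⟨hxΓ, hP⟩]; exact hxO⟩
  have h1 := euclideanHausdorffMeasure_image_le_image (f := fun y : Plane => y) (g := P.ψ)
    (s := P.V ∩ P.ψ ⁻¹' O) (C := 1) (fun a _ b _ => by
      rw [edist_dist, edist_dist, ENNReal.coe_one, one_mul, dist_eq_norm, dist_eq_norm]
      refine ENNReal.ofReal_le_ofReal ?_
      simpa using P.frame.norm_L_le (P.ψ a - P.ψ b)) 2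
  rw [image_id', EuclideanSpace.euclideanHausdorffMeasure_eq_volume, ENNReal.coe_one, one_pow,
    one_mul] at h1
  refine (hopen.measure_pos volume hne).trans_le (h1.trans (measure_mono ?_))
  rintro _ ⟨y, hy, rfl⟩
  exact ⟨hy.2, (P.ψ_mem hy.1).1⟩

lemma surfaceMeasure_restrict_self (hΓ : IsClosedSurface Γ) :
    (surfaceMeasure Γ).restrict Γ = surfaceMeasure Γ := by
  rw [surfaceMeasure, Measure.restrict_restrict hΓ.isCompact.measurableSet, inter_self]

lemma IsClosedSurface.integrable (hΓ : IsClosedSurface Γ) {f : E3 → ℝ} (hf : ContinuousOn f Γ) :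
    Integrable f (surfaceMeasure Γ) := by
  have := hΓ.isFiniteMeasure
  have h : IntegrableOn f Γ (surfaceMeasure Γ) := hf.integrableOn_compact hΓ.isCompact
  rwa [IntegrableOn, surfaceMeasure_restrict_self hΓ] at h

end SurfaceMeasure

/-- Integration by parts against the constant function 1. -/
lemma integral_fderiv_apply_eq_zero {g : Plane → ℝ} (hg : ContDiff ℝ 1 g)
    (hc : HasCompactSupport g) (v : Plane) : ∫ y, fderiv ℝ g y v = 0 := by
  have hcont : Continuous fun y => fderiv ℝ g y v :=
    (hg.continuous_fderiv one_ne_zero).clm_apply continuous_const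
  have hcs : HasCompactSupport fun y => fderiv ℝ g y v := hc.fderiv_apply ℝ v
  have h := integral_mul_fderiv_eq_neg_fderiv_mul_of_integrable (μ := (volume : Measure Plane))
    (f := fun _ : Plane => (1 : ℝ)) (g := g) (v := v) (by simp)
    (by simpa using hcont.integrable_of_hasCompactSupport hcs)
    (by simpa using hg.continuous.integrable_of_hasCompactSupport hc)
    (fun _ _ => differentiableAt_const _)
    (fun y _ => hg.differentiable one_ne_zero y)
  simpa using h

/-- The divergence theorem for compactly supported `C¹` fields in the plane. -/
lemma integral_trace_fderiv_eq_zero {X : Plane → Plane} (hX : ContDiff ℝ 1 X)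
    (hc : HasCompactSupport X) :
    ∫ y, LinearMap.trace ℝ Plane (fderiv ℝ X y : Plane →ₗ[ℝ] Plane) = 0 := by
  let b := EuclideanSpace.basisFun (Fin 2) ℝ
  have hg : ∀ i, ContDiff ℝ 1 fun y => ⟪b i, X y⟫ := fun i => contDiff_const.inner ℝ hX
  have hgc : ∀ i, HasCompactSupport fun y => ⟪b i, X y⟫ := fun i =>
    hc.comp_left (g := fun v => ⟪b i, v⟫) (inner_zero_right _)
  have hfd : ∀ i y, ⟪b i, fderiv ℝ X y (b i)⟫ = fderiv ℝ (fun y => ⟪b i, X y⟫) y (b i) :=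
    fun i y => by
      have := ((innerSL ℝ (b i)).hasFDerivAt.comp y
        (hX.differentiable one_ne_zero y).hasFDerivAt).fderiv
      exact (congrArg (fun A : Plane →L[ℝ] ℝ => A (b i)) this).symm
  have htr : ∀ y, LinearMap.trace ℝ Plane (fderiv ℝ X y : Plane →ₗ[ℝ] Plane)
      = ∑ i, fderiv ℝ (fun y => ⟪b i, X y⟫) y (b i) := fun y => by
    rw [LinearMap.trace_eq_sum_inner _ b]
    exact Finset.sum_congr rfl fun i _ => hfd i y
  simp only [htr]
  rw [integral_finsetSum]
  · exact Finset.sum_eq_zero fun i _ => integral_fderiv_apply_eq_zero (hg i) (hgc i) _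
  · intro i _
    exact Continuous.integrable_of_hasCompactSupport
      (((hg i).continuous_fderiv one_ne_zero).clm_apply continuous_const)
      ((hgc i).fderiv_apply ℝ _)

namespace GraphPatch

variable {Γ : Set E3} (P : GraphPatch Γ)

/-- The area density of the patch. -/
def density (y : Plane) : ℝ := √(1 + ‖fderiv ℝ P.h y‖ ^ 2)

lemma density_sq (y : Plane) : P.density y ^ 2 = 1 + ‖fderiv ℝ P.h y‖ ^ 2 :=
  Real.sq_sqrt (by positivity)

lemma density_pos (y : Plane) : 0 < P.density y := Real.sqrt_pos.2 (by positivity)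

lemma hasFDerivAt_fderiv_h {y : Plane} (hy : y ∈ P.V) :
    HasFDerivAt (fderiv ℝ P.h) (fderiv ℝ (fderiv ℝ P.h) y) y :=
  ((P.contDiffOn_fderiv_h.contDiffAt (P.isOpen_V.mem_nhds hy)).differentiableAt
    one_ne_zero).hasFDerivAt

lemma density_eq (y : Plane) : P.density y = √(1 + ‖gradient P.h y‖ ^ 2) := by
  simp [density, gradient]

lemma contDiffOn_gradient_h : ContDiffOn ℝ 1 (gradient P.h) P.V :=
  (InnerProductSpace.toDual ℝ Plane).symm.toContinuousLinearEquiv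
    |>.contDiff.comp_contDiffOn P.contDiffOn_fderiv_h

lemma contDiffOn_density : ContDiffOn ℝ 1 P.density P.V := by
  have : P.density = fun y => √(1 + ‖gradient P.h y‖ ^ 2) := funext P.density_eq
  rw [this]
  exact ContDiffOn.sqrt (contDiffOn_const.add (P.contDiffOn_gradient_h.norm_sq ℝ))
    fun y _ => by positivity

lemma fderiv_density_apply {y : Plane} (hy : y ∈ P.V) (w : Plane) :
    fderiv ℝ P.density y w
      = fderiv ℝ (fderiv ℝ P.h) y w (gradient P.h y) / P.density y := by
  have hG : HasFDerivAt (gradient P.h)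
      ((InnerProductSpace.toDual ℝ Plane).symm.toContinuousLinearEquiv.toContinuousLinearMap ∘L
        fderiv ℝ (fderiv ℝ P.h) y) y :=
    (InnerProductSpace.toDual ℝ Plane).symm.toContinuousLinearEquiv.toContinuousLinearMap.hasFDerivAt.comp
      y (P.hasFDerivAt_fderiv_h hy)
  have h1 := (hG.norm_sq.const_add 1).sqrt (by positivity)
  have h2 : P.density = fun y => √(1 + ‖gradient P.h y‖ ^ 2) := funext P.density_eq
  rw [P.density_eq, h2, h1.fderiv]
  simp only [smul_apply, ContinuousLinearMap.comp_apply, innerSL_apply_apply,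
    smul_eq_mul]
  have h4 : ⟪gradient P.h y, (InnerProductSpace.toDual ℝ Plane).symm
      (fderiv ℝ (fderiv ℝ P.h) y w)⟫ = fderiv ℝ (fderiv ℝ P.h) y w (gradient P.h y) := by
    rw [real_inner_comm, InnerProductSpace.toDual_symm_apply]
  change _ * (2 • ⟪gradient P.h y, (InnerProductSpace.toDual ℝ Plane).symm
      (fderiv ℝ (fderiv ℝ P.h) y w)⟫) = _
  rw [h4]
  have : √(1 + ‖gradient P.h y‖ ^ 2) ≠ 0 := (Real.sqrt_pos.2 (by positivity)).ne'
  field_simp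
  simp [two_mul]

/-- Needed for the vertical part of `div_Γ W`: the trace of the rank-one map `(c ∘ L ∘ P) ⊗ n` is `c
(L (P n))`. -/
lemma L_tangentProj_n {x : E3} (hx : x ∈ Γ ∩ P.U) :
    P.frame.L (tangentProj Γ x P.frame.n)
      = (P.density (P.frame.L x) ^ 2)⁻¹ • gradient P.h (P.frame.L x) := by
  rw [P.tangentProj_apply hx, P.inner_normal_self, ← P.density_sq, P.inner_normal,
    P.frame.inner_self_n, P.frame.L_n, map_zero, sub_zero, map_sub, map_smul, P.frame.L_n, normal,
    map_sub, P.frame.L_n, P.frame.L_ι]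
  simp

lemma tangentProj_graphLin {y : Plane} (hy : y ∈ P.V) (z : Plane) :
    tangentProj Γ (P.ψ y) (P.frame.graphLin (fderiv ℝ P.h y) z)
      = P.frame.graphLin (fderiv ℝ P.h y) z := by
  refine tangentProj_eq_self ?_
  rw [P.tangentPlane_eq (P.ψ_mem hy), Submodule.mem_orthogonal_singleton_iff_inner_right,
    P.inner_normal, P.L_ψ, P.frame.L_graphLin, P.frame.graphLin_apply, inner_add_right,
    P.frame.inner_ι, inner_smul_right, P.frame.inner_self_n]
  simp

lemma eq_graphLin_of_mem_tangentPlane {y : Plane} (hy : y ∈ P.V) {v : E3}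
    (hv : v ∈ tangentPlane Γ (P.ψ y)) :
    v = P.frame.graphLin (fderiv ℝ P.h y) (P.frame.L v) := by
  rw [P.tangentPlane_eq (P.ψ_mem hy), Submodule.mem_orthogonal_singleton_iff_inner_right,
    P.inner_normal, P.L_ψ, sub_eq_zero] at hv
  rw [P.frame.graphLin_apply, ← hv, P.frame.decomp]

/-- In the graph parametrization, `J · div_Γ W` is the plane divergence of `J · L W`. -/
lemma density_mul_surfaceDiv {W : E3 → E3} (hW : ContDiffOn ℝ 1 W Γ)
    (hWt : ∀ x ∈ Γ, W x ∈ tangentPlane Γ x) {y : Plane} (hy : y ∈ P.V) :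
    P.density y * surfaceDiv Γ W (P.ψ y)
      = LinearMap.trace ℝ Plane
        (fderiv ℝ (fun z => P.density z • P.frame.L (W (P.ψ z))) y : Plane →ₗ[ℝ] Plane) := by
  set w : Plane → Plane := fun z => P.frame.L (W (P.ψ z)) with hw
  set D2 := fderiv ℝ (fderiv ℝ P.h) y with hD2
  have hψΓ : MapsTo P.ψ P.V Γ := fun z hz => (P.ψ_mem hz).1
  have hwC : ContDiffOn ℝ 1 w P.V :=
    P.frame.L.contDiff.comp_contDiffOn (hW.comp (P.contDiffOn_ψ.of_le one_le_two) hψΓ)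
  have hw' : HasFDerivAt w (fderiv ℝ w y) y :=
    ((hwC.contDiffAt (P.isOpen_V.mem_nhds hy)).differentiableAt one_ne_zero).hasFDerivAt
  set w' := fderiv ℝ w y with hw'def
  set A := P.frame.graphLin (fderiv ℝ P.h y) with hA
  set c : Plane →L[ℝ] ℝ := D2.flip (w y) with hc
  -- A tangential field is determined by its horizontal part `w`: its vertical component is `Dh(w)`.
  -- Differentiating `Dh` produces the second-derivative term `c`.
  have hB : HasFDerivAt (fun z => P.frame.ι (w z) + fderiv ℝ P.h z (w z) • P.frame.n)
      (A ∘L w' + c.smulRight P.frame.n) y := by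
    have h1 : HasFDerivAt (fun z => P.frame.ι (w z))
        (P.frame.ι.toContinuousLinearMap ∘L w') y :=
      P.frame.ι.toContinuousLinearMap.hasFDerivAt.comp y hw'
    have h2 := ((P.hasFDerivAt_fderiv_h hy).clm_apply hw').smul_const P.frame.n
    refine (h1.add h2).congr_fderiv ?_
    ext1 e
    simp only [hA, hc, add_apply, ContinuousLinearMap.comp_apply, NormalFrame.graphLin_apply,
      ContinuousLinearMap.smulRight_apply, ContinuousLinearMap.flip_apply,
      LinearIsometry.coe_toContinuousLinearMap, add_smul]
    abel
  have hψy : P.ψ y ∈ Γ ∩ P.U := P.ψ_mem hy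
  -- On the patch `W` coincides with its extension constant along vertical lines, whose derivative
  -- serves as a derivative of `W` within `Γ`.
  have hWder : HasFDerivWithinAt W ((A ∘L w' + c.smulRight P.frame.n) ∘L P.frame.L) Γ (P.ψ y) := by
    have h1 : HasFDerivAt (fun x => P.frame.ι (w (P.frame.L x))
        + fderiv ℝ P.h (P.frame.L x) (w (P.frame.L x)) • P.frame.n)
        ((A ∘L w' + c.smulRight P.frame.n) ∘L P.frame.L) (P.ψ y) :=
      HasFDerivAt.comp (f := P.frame.L)
        (g := fun z => P.frame.ι (w z) + fderiv ℝ P.h z (w z) • P.frame.n)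
        (P.ψ y) (by rw [P.L_ψ]; exact hB) P.frame.L.hasFDerivAt
    refine (EventuallyEq.hasFDerivWithinAt_iff_of_mem ?_ hψy.1).2 h1.hasFDerivWithinAt
    filter_upwards [P.mem_nhdsWithin_U hψy.2] with x hx
    have h2 := P.eq_graphLin_of_mem_tangentPlane (P.mapsTo_L hx.2) (v := W x)
      (by rw [P.ψ_L hx]; exact hWt x hx.1)
    rw [P.frame.graphLin_apply] at h2
    simp only [hw, P.ψ_L hx]
    exact h2
  have htr1 : traceCLM ((A ∘L w' ∘L P.frame.L) ∘L tangentProj Γ (P.ψ y))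
      = LinearMap.trace ℝ Plane (w' : Plane →ₗ[ℝ] Plane) := by
    rw [traceCLM_apply]
    -- Cyclicity of the trace moves `A` to the right, where `L ∘ P ∘ A` is the identity of the
    -- plane.
    have := LinearMap.trace_comp_comm' (A : Plane →ₗ[ℝ] E3)
      ((w' ∘L P.frame.L ∘L tangentProj Γ (P.ψ y) : E3 →L[ℝ] Plane) : E3 →ₗ[ℝ] Plane)
    refine Eq.trans this.symm ?_
    congr 1
    ext1 z
    change w' (P.frame.L (tangentProj Γ (P.ψ y) (A z))) = w' z
    rw [hA, P.tangentProj_graphLin hy, P.frame.L_graphLin]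
  have htr2 : traceCLM ((c.smulRight P.frame.n ∘L P.frame.L) ∘L tangentProj Γ (P.ψ y))
      = (P.density y ^ 2)⁻¹ * D2 (gradient P.h y) (w y) := by
    have h1 : (((c.smulRight P.frame.n ∘L P.frame.L) ∘L tangentProj Γ (P.ψ y) : E3 →L[ℝ] E3) :
        E3 →ₗ[ℝ] E3) = LinearMap.smulRight ((c ∘L P.frame.L ∘L tangentProj Γ (P.ψ y) :
          E3 →L[ℝ] ℝ) : E3 →ₗ[ℝ] ℝ) P.frame.n := by
      ext1 v; rfl
    rw [traceCLM_apply, h1, LinearMap.trace_smulRight]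
    change c (P.frame.L (tangentProj Γ (P.ψ y) P.frame.n)) = _
    rw [P.L_tangentProj_n hψy, P.L_ψ, map_smul, smul_eq_mul]
    rfl
  have hdiv : surfaceDiv Γ W (P.ψ y) = LinearMap.trace ℝ Plane (w' : Plane →ₗ[ℝ] Plane)
      + (P.density y ^ 2)⁻¹ * D2 (gradient P.h y) (w y) := by
    rw [surfaceDiv_eq hWder, ContinuousLinearMap.add_comp, ContinuousLinearMap.add_comp, map_add,
      htr2, ContinuousLinearMap.comp_assoc A, htr1]
  have hJ : HasFDerivAt P.density (fderiv ℝ P.density y) y :=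
    ((P.contDiffOn_density.contDiffAt (P.isOpen_V.mem_nhds hy)).differentiableAt
      one_ne_zero).hasFDerivAt
  have hX : fderiv ℝ (fun z => P.density z • w z) y
      = P.density y • w' + (fderiv ℝ P.density y).smulRight (w y) := (hJ.fun_smul hw').fderiv
  have htr3 : LinearMap.trace ℝ Plane
      (((P.density y • w' + (fderiv ℝ P.density y).smulRight (w y) : Plane →L[ℝ] Plane)) :
        Plane →ₗ[ℝ] Plane)
      = P.density y * LinearMap.trace ℝ Plane (w' : Plane →ₗ[ℝ] Plane)
        + fderiv ℝ P.density y (w y) := by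
    have h1 : (((P.density y • w' + (fderiv ℝ P.density y).smulRight (w y) :
        Plane →L[ℝ] Plane)) : Plane →ₗ[ℝ] Plane)
        = P.density y • (w' : Plane →ₗ[ℝ] Plane)
          + LinearMap.smulRight (fderiv ℝ P.density y : Plane →ₗ[ℝ] ℝ) (w y) := by
      ext1 v; rfl
    rw [h1, map_add, map_smul, LinearMap.trace_smulRight]
    rfl
  -- Symmetry of `D²h` matches the vertical term with the derivative of the density along `w`.
  have hsymm : D2 (gradient P.h y) (w y) = D2 (w y) (gradient P.h y) :=
    (P.contDiffAt_h hy).isSymmSndFDerivAt (by simp) _ _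
  rw [hX, htr3, hdiv, P.fderiv_density_apply hy, hsymm, hD2]
  have := (P.density_pos y).ne'
  field_simp

/-- The divergence theorem for tangential fields supported in a patch. -/
lemma integral_surfaceDiv_eq_zero (hΓ : IsClosedSurface Γ) {W : E3 → E3}
    (hW : ContDiffOn ℝ 1 W Γ) (hWt : ∀ x ∈ Γ, W x ∈ tangentPlane Γ x) {S : Set E3}
    (hS : IsCompact S) (hSU : S ⊆ Γ ∩ P.U) (hWS : ∀ x ∈ Γ, x ∉ S → W x = 0) :
    ∫ x, surfaceDiv Γ W x ∂(surfaceMeasure Γ) = 0 := by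
  classical
  set Y : Plane → Plane := fun z => P.density z • P.frame.L (W (P.ψ z)) with hY
  -- Extension by zero stays `C¹` because the support lies in the compact set `T`, which is
  -- contained in the open set `V`.
  set X : Plane → Plane := P.V.indicator Y with hX
  set T : Set Plane := P.frame.L '' S with hT
  have hTc : IsCompact T := hS.image P.frame.L.continuous
  have hψΓ : MapsTo P.ψ P.V Γ := fun z hz => (P.ψ_mem hz).1
  have hYC : ContDiffOn ℝ 1 Y P.V := P.contDiffOn_density.smul
    (P.frame.L.contDiff.comp_contDiffOn (hW.comp (P.contDiffOn_ψ.of_le one_le_two) hψΓ))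
  have hX0 : ∀ y, y ∉ T → X y = 0 := fun y hy => by
    by_cases hyV : y ∈ P.V
    · rw [hX, indicator_of_mem hyV]
      have : P.ψ y ∉ S := fun h => hy ⟨_, h, P.L_ψ y⟩
      simp [hY, hWS _ (hψΓ hyV) this]
    · exact indicator_of_notMem hyV _
  have hTV : T ⊆ P.V := by
    rintro _ ⟨x, hx, rfl⟩
    exact P.mapsTo_L (hSU hx).2
  have hXY : ∀ y ∈ P.V, X =ᶠ[𝓝 y] Y := fun y hy => by
    filter_upwards [P.isOpen_V.mem_nhds hy] with z hz using indicator_of_mem hz _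
  have hXoff : ∀ y, y ∉ P.V → X =ᶠ[𝓝 y] fun _ => 0 := fun y hy => by
    filter_upwards [hTc.isClosed.isOpen_compl.mem_nhds fun h => hy (hTV h)] with z hz
      using hX0 z hz
  have hXC : ContDiff ℝ 1 X := contDiff_iff_contDiffAt.2 fun y => by
    by_cases hyV : y ∈ P.V
    · exact (hYC.contDiffAt (P.isOpen_V.mem_nhds hyV)).congr_of_eventuallyEq (hXY y hyV)
    · exact contDiffAt_const.congr_of_eventuallyEq (hXoff y hyV)
  have hXc : HasCompactSupport X := HasCompactSupport.intro hTc fun y hy => hX0 y hy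
  have hdiv0 : ∀ x ∈ Γ, x ∉ P.U → surfaceDiv Γ W x = 0 := fun x hx hxU => by
    have h1 : HasFDerivWithinAt W (0 : E3 →L[ℝ] E3) Γ x := by
      refine (EventuallyEq.hasFDerivWithinAt_iff_of_mem ?_ hx).2
        (hasFDerivWithinAt_const (0 : E3) x Γ)
      filter_upwards [self_mem_nhdsWithin, mem_nhdsWithin_of_mem_nhds
        (hS.isClosed.isOpen_compl.mem_nhds fun h => hxU (hSU h).2)] with z hz hzS
        using hWS z hz hzS
    rw [surfaceDiv_eq h1, ContinuousLinearMap.zero_comp, map_zero]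
  have hΓm : MeasurableSet Γ := hΓ.isCompact.measurableSet
  calc ∫ x, surfaceDiv Γ W x ∂(surfaceMeasure Γ)
      = ∫ x in Γ ∩ P.U, surfaceDiv Γ W x ∂(Measure.euclideanHausdorffMeasure 2) := by
        refine setIntegral_eq_of_subset_of_forall_sdiff_eq_zero hΓm inter_subset_left ?_
        exact fun x hx => hdiv0 x hx.1 fun h => hx.2 ⟨hx.1, h⟩
    _ = ∫ y in P.V, √(1 + ‖fderiv ℝ P.h y‖ ^ 2) * surfaceDiv Γ W (P.frame.graphMap P.h y) := by
        rw [P.inter_eq]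
        refine P.frame.setIntegral_image_graphMap P.isOpen_V P.volume_V
          (P.contDiffOn_h.of_le one_le_two) P.lipschitz ?_
        rw [← P.inter_eq]
        exact (continuousOn_surfaceDiv_space hΓ hW).mono inter_subset_left
    _ = ∫ y in P.V, LinearMap.trace ℝ Plane (fderiv ℝ X y : Plane →ₗ[ℝ] Plane) := by
        refine setIntegral_congr_fun P.isOpen_V.measurableSet fun y hy => ?_
        simp only [(hXY y hy).fderiv_eq]
        exact P.density_mul_surfaceDiv hW hWt hy
    _ = ∫ y, LinearMap.trace ℝ Plane (fderiv ℝ X y : Plane →ₗ[ℝ] Plane) := by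
        refine setIntegral_eq_integral_of_forall_compl_eq_zero fun y hy => ?_
        rw [(hXoff y hy).fderiv_eq]
        simp
    _ = 0 := integral_trace_fderiv_eq_zero hXC hXc

end GraphPatch

/-- The divergence theorem on a closed surface. -/
theorem IsClosedSurface.integral_surfaceDiv_eq_zero {Γ : Set E3} (hΓ : IsClosedSurface Γ)
    {W : E3 → E3} (hW : ContDiffOn ℝ 1 W Γ) (hWt : ∀ x ∈ Γ, W x ∈ tangentPlane Γ x) :
    ∫ x, surfaceDiv Γ W x ∂(surfaceMeasure Γ) = 0 := by
  have := hΓ.isFiniteMeasure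
  obtain ⟨t, htcov⟩ := hΓ.isCompact.elim_finite_subcover (fun P : GraphPatch Γ => P.U)
    (fun P => P.isOpen_U) fun x hx => by
      obtain ⟨P, hP⟩ := hΓ.exists_graphPatch hx
      exact mem_iUnion.2 ⟨P, hP⟩
  -- Multiplying by scalar cutoffs keeps each piece tangential and places it in a single patch.
  obtain ⟨f, hf⟩ := SmoothPartitionOfUnity.exists_isSubordinate 𝓘(ℝ, E3) hΓ.isCompact.isClosed
    (fun P : t => P.1.U) (fun P => P.1.isOpen_U) fun x hx => by
      obtain ⟨i, hi, hxi⟩ := mem_iUnion₂.1 (htcov hx)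
      exact mem_iUnion.2 ⟨⟨i, hi⟩, hxi⟩
  have hfC : ∀ i, ContDiff ℝ 1 (f i) := fun i => (f i).contMDiff.contDiff.of_le (by simp)
  have hWi : ∀ i, ContDiffOn ℝ 1 (fun x => f i x • W x) Γ := fun i =>
    (hfC i).contDiffOn.smul hW
  have hsum : EqOn W (fun x => ∑ i, f i x • W x) Γ := fun x hx => by
    have h1 := f.sum_eq_one hx
    rw [finsum_eq_sum_of_fintype] at h1
    simp only [← Finset.sum_smul, h1, one_smul]
  have hae : ∀ᵐ x ∂(surfaceMeasure Γ), surfaceDiv Γ W x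
      = ∑ i, surfaceDiv Γ (fun x => f i x • W x) x := by
    filter_upwards [ae_restrict_mem hΓ.isCompact.measurableSet] with x hx
    rw [surfaceDiv_congr hsum hx, surfaceDiv_sum]
    exact fun i _ => (hWi i).differentiableOn one_ne_zero x hx
  rw [integral_congr_ae hae, integral_finsetSum]
  · refine Finset.sum_eq_zero fun i _ => ?_
    refine i.1.integral_surfaceDiv_eq_zero hΓ (hWi i)
      (fun x hx => Submodule.smul_mem _ _ (hWt x hx)) (S := tsupport (f i) ∩ Γ)
      (hΓ.isCompact.inter_left (isClosed_tsupport _)) (fun x hx => ⟨hx.2, hf i hx.1⟩) ?_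
    intro x hx hxS
    rw [image_eq_zero_of_notMem_tsupport fun h => hxS ⟨h, hx⟩, zero_smul]
  · intro i _
    exact hΓ.integrable (continuousOn_surfaceDiv_space hΓ (hWi i))

end

/-! ### Space-time integration, the fundamental lemma and integration by parts. -/

section

open Metric Filter Topology
open scoped NNReal ENNReal RealInnerProductSpace

/-- A continuous nonnegative function with zero integral vanishes on the support of the measure. -/
lemma eqOn_zero_of_integral_eq_zero {X : Type*} [TopologicalSpace X] [MeasurableSpace X]
    {μ : Measure X} {K : Set X}
    (hpos : ∀ O, IsOpen O → ∀ x ∈ K, x ∈ O → 0 < μ O) (hae : ∀ᵐ x ∂μ, x ∈ K) {f : X → ℝ}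
    (hf : ContinuousOn f K) (hint : Integrable f μ) (h0 : ∀ x ∈ K, 0 ≤ f x)
    (hI : ∫ x, f x ∂μ = 0) : ∀ x ∈ K, f x = 0 := by
  have hnn : 0 ≤ᵐ[μ] f := by filter_upwards [hae] with x hx using h0 x hx
  have hz := (integral_eq_zero_iff_of_nonneg_ae hnn hint).1 hI
  intro x hx
  by_contra hne
  obtain ⟨O, hO, hOK⟩ := (_root_.continuousOn_iff'.1 hf) {0}ᶜ isOpen_compl_singleton
  have hxO : x ∈ O := by
    have : x ∈ f ⁻¹' {0}ᶜ ∩ K := ⟨hne, hx⟩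
    rw [hOK] at this
    exact this.1
  refine (hpos O hO x hx hxO).ne' (measure_eq_zero_iff_ae_notMem.2 ?_)
  filter_upwards [hz, hae] with y hy hyK hyO
  have : y ∈ f ⁻¹' {0}ᶜ ∩ K := by rw [hOK]; exact ⟨hyO, hyK⟩
  exact this.1 hy

/-- The product measure on space-time. -/
def cylinderMeasure (Γ : Set E3) : Measure (ℝ × E3) :=
  (volume.restrict (Icc (0 : ℝ) 1)).prod (surfaceMeasure Γ)

section Cylinder

variable {Γ : Set E3}

lemma IsClosedSurface.isCompact_cylinder (hΓ : IsClosedSurface Γ) : IsCompact (cylinder Γ) :=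
  isCompact_Icc.prod hΓ.isCompact

lemma cylinderMeasure_restrict_self (hΓ : IsClosedSurface Γ) :
    (cylinderMeasure Γ).restrict (cylinder Γ) = cylinderMeasure Γ := by
  have := hΓ.isFiniteMeasure
  rw [cylinderMeasure, ← Measure.prod_restrict, surfaceMeasure_restrict_self hΓ,
    Measure.restrict_restrict measurableSet_Icc, inter_self]

lemma IsClosedSurface.isFiniteMeasure_cylinder (hΓ : IsClosedSurface Γ) :
    IsFiniteMeasure (cylinderMeasure Γ) := by
  have := hΓ.isFiniteMeasure
  rw [cylinderMeasure]
  infer_instance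

lemma ae_mem_cylinder (hΓ : IsClosedSurface Γ) : ∀ᵐ z ∂(cylinderMeasure Γ), z ∈ cylinder Γ := by
  rw [← cylinderMeasure_restrict_self hΓ]
  exact ae_restrict_mem (measurableSet_Icc.prod hΓ.isCompact.measurableSet)

lemma integrable_cylinder (hΓ : IsClosedSurface Γ) {f : ℝ × E3 → ℝ}
    (hf : ContinuousOn f (cylinder Γ)) : Integrable f (cylinderMeasure Γ) := by
  have := hΓ.isFiniteMeasure_cylinder
  have h : IntegrableOn f (cylinder Γ) (cylinderMeasure Γ) :=
    hf.integrableOn_compact hΓ.isCompact_cylinder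
  rwa [IntegrableOn, cylinderMeasure_restrict_self hΓ] at h

lemma cylinderMeasure_pos (hΓ : IsClosedSurface Γ) {O : Set (ℝ × E3)} (hO : IsOpen O)
    {z : ℝ × E3} (hz : z ∈ cylinder Γ) (hzO : z ∈ O) : 0 < cylinderMeasure Γ O := by
  have := hΓ.isFiniteMeasure
  obtain ⟨I, B, hI, hB, hzI, hzB, hsub⟩ := isOpen_prod_iff.1 hO z.1 z.2 hzO
  refine lt_of_lt_of_le ?_ (measure_mono hsub)
  rw [cylinderMeasure, Measure.prod_prod, Measure.restrict_apply hI.measurableSet]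
  refine ENNReal.mul_pos (ne_of_gt ?_) (hΓ.measure_pos_of_isOpen hB hz.2 hzB).ne'
  -- At `t = 0` or `t = 1` only part of the time neighbourhood lies in `[0, 1]`, but it still meets
  -- the open interval.
  have hcl : z.1 ∈ closure (Ioo (0 : ℝ) 1) := by
    rw [closure_Ioo zero_ne_one]; exact hz.1
  have hne : (I ∩ Ioo (0 : ℝ) 1).Nonempty := mem_closure_iff.1 hcl I hI hzI
  exact ((hI.inter isOpen_Ioo).measure_pos volume hne).trans_le
    (measure_mono (inter_subset_inter_right _ Ioo_subset_Icc_self))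

lemma integral_cylinder (hΓ : IsClosedSurface Γ) {f : ℝ → E3 → ℝ}
    (hf : ContinuousOn (fun z : ℝ × E3 => f z.1 z.2) (cylinder Γ)) :
    ∫ z, f z.1 z.2 ∂(cylinderMeasure Γ)
      = ∫ t in (0 : ℝ)..1, ∫ x, f t x ∂(surfaceMeasure Γ) := by
  have := hΓ.isFiniteMeasure
  rw [intervalIntegral.integral_of_le zero_le_one, ← integral_Icc_eq_integral_Ioc]
  exact integral_prod _ (integrable_cylinder hΓ hf)

lemma integral_cylinder_symm (hΓ : IsClosedSurface Γ) {f : ℝ → E3 → ℝ}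
    (hf : ContinuousOn (fun z : ℝ × E3 => f z.1 z.2) (cylinder Γ)) :
    ∫ z, f z.1 z.2 ∂(cylinderMeasure Γ)
      = ∫ x, (∫ t in (0 : ℝ)..1, f t x) ∂(surfaceMeasure Γ) := by
  have := hΓ.isFiniteMeasure
  simp only [intervalIntegral.integral_of_le zero_le_one, ← integral_Icc_eq_integral_Ioc]
  exact integral_prod_symm _ (integrable_cylinder hΓ hf)

/-- The fundamental lemma of the calculus of variations on space-time. -/
theorem eqOn_zero_of_forall_integral_mul_eq_zero (hΓ : IsClosedSurface Γ) {f : ℝ × E3 → ℝ}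
    (hf : ContinuousOn f (cylinder Γ))
    (h : ∀ χ : ℝ × E3 → ℝ, ContDiff ℝ 1 χ → ∫ z, f z * χ z ∂(cylinderMeasure Γ) = 0) :
    ∀ z ∈ cylinder Γ, f z = 0 := by
  suffices hle : ∀ g : ℝ × E3 → ℝ, ContinuousOn g (cylinder Γ) →
      (∀ χ : ℝ × E3 → ℝ, ContDiff ℝ 1 χ → ∫ z, g z * χ z ∂(cylinderMeasure Γ) = 0) →
      ∀ z ∈ cylinder Γ, g z ≤ 0 by
    intro z hz
    refine le_antisymm (hle f hf h z hz) ?_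
    have := hle (fun z => -f z) hf.neg (fun χ hχ => by
      simp only [neg_mul, integral_neg, h χ hχ, neg_zero]) z hz
    linarith
  intro g hg hint z hz
  by_contra! hpos
  obtain ⟨O, hO, hOK⟩ := (_root_.continuousOn_iff'.1 hg) (Ioi 0) isOpen_Ioi
  have hzO : z ∈ O := by
    have : z ∈ g ⁻¹' Ioi 0 ∩ cylinder Γ := ⟨hpos, hz⟩
    rw [hOK] at this
    exact this.1
  -- A bump supported where `g` is positive: `g χ` is nonnegative with zero integral, hence zero,
  -- although it equals `g z > 0` at `z`.
  obtain ⟨χ, hsupp, -, hχ, hrange, hχz⟩ := exists_contDiff_tsupport_subset (n := 1)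
    (hO.mem_nhds hzO)
  have hcont : ContinuousOn (fun z => g z * χ z) (cylinder Γ) :=
    hg.mul hχ.continuous.continuousOn
  have h0 := eqOn_zero_of_integral_eq_zero
    (fun O hO x hx hxO => cylinderMeasure_pos hΓ hO hx hxO) (ae_mem_cylinder hΓ) hcont
    (integrable_cylinder hΓ hcont) (fun w hw => by
      by_cases hwO : w ∈ O
      · have : w ∈ g ⁻¹' Ioi 0 ∩ cylinder Γ := by rw [hOK]; exact ⟨hwO, hw⟩
        exact mul_nonneg (le_of_lt this.1) (hrange (mem_range_self w)).1
      · rw [image_eq_zero_of_notMem_tsupport fun h => hwO (hsupp h), mul_zero])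
    (hint χ (by exact_mod_cast hχ)) z hz
  rw [hχz, mul_one] at h0
  exact (ne_of_gt hpos) h0

/-- Integration by parts in space. -/
theorem integral_mul_surfaceDiv_add (hΓ : IsClosedSurface Γ) {φ : ℝ → E3 → ℝ} {W : ℝ → E3 → E3}
    (hφ : ContDiffOn ℝ 1 (fun z : ℝ × E3 => φ z.1 z.2) (cylinder Γ))
    (hW : ContDiffOn ℝ 1 (fun z : ℝ × E3 => W z.1 z.2) (cylinder Γ))
    (hWt : ∀ t ∈ Icc (0 : ℝ) 1, ∀ x ∈ Γ, W t x ∈ tangentPlane Γ x) :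
    ∫ z, (φ z.1 z.2 * surfaceDiv Γ (W z.1) z.2 + ⟪surfaceGrad Γ (φ z.1) z.2, W z.1 z.2⟫)
      ∂(cylinderMeasure Γ) = 0 := by
  have hcont : ContinuousOn (fun z : ℝ × E3 => φ z.1 z.2 * surfaceDiv Γ (W z.1) z.2
      + ⟪surfaceGrad Γ (φ z.1) z.2, W z.1 z.2⟫) (cylinder Γ) :=
    (hφ.continuousOn.mul (continuousOn_surfaceDiv hΓ hW)).add
      ((continuousOn_surfaceGrad hΓ hφ).inner hW.continuousOn)
  rw [integral_cylinder hΓ (f := fun t x => φ t x * surfaceDiv Γ (W t) x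
    + ⟪surfaceGrad Γ (φ t) x, W t x⟫) hcont]
  have h0 : ∀ t ∈ Icc (0 : ℝ) 1, ∫ x, (φ t x * surfaceDiv Γ (W t) x
      + ⟪surfaceGrad Γ (φ t) x, W t x⟫) ∂(surfaceMeasure Γ) = 0 := fun t ht => by
    rw [← hΓ.integral_surfaceDiv_eq_zero ((contDiffOn_space hφ ht).smul (contDiffOn_space hW ht))
      fun x hx => Submodule.smul_mem _ _ (hWt t ht x hx)]
    refine integral_congr_ae ?_
    filter_upwards [ae_restrict_mem hΓ.isCompact.measurableSet] with x hx
    exact (surfaceDiv_smul (differentiableWithinAt_space hφ (z := (t, x)) ⟨ht, hx⟩)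
      (differentiableWithinAt_space hW (z := (t, x)) ⟨ht, hx⟩) (hWt t ht x hx)).symm
  rw [intervalIntegral.integral_congr (g := fun _ => (0 : ℝ)) fun t ht => h0 t (by
    rwa [uIcc_of_le zero_le_one] at ht)]
  simp

/-- Integration by parts in time. -/
theorem integral_mul_timeDeriv_add (hΓ : IsClosedSurface Γ) {φ τ : ℝ → E3 → ℝ}
    (hφ : ContDiffOn ℝ 1 (fun z : ℝ × E3 => φ z.1 z.2) (cylinder Γ))
    (hτ : ContDiffOn ℝ 1 (fun z : ℝ × E3 => τ z.1 z.2) (cylinder Γ))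
    (h0 : ∀ x, τ 0 x = 0) (h1 : ∀ x, τ 1 x = 0) :
    ∫ z, (timeDeriv φ z.1 z.2 * τ z.1 z.2 + φ z.1 z.2 * timeDeriv τ z.1 z.2)
      ∂(cylinderMeasure Γ) = 0 := by
  have hcont : ContinuousOn (fun z : ℝ × E3 => timeDeriv φ z.1 z.2 * τ z.1 z.2
      + φ z.1 z.2 * timeDeriv τ z.1 z.2) (cylinder Γ) :=
    ((continuousOn_timeDeriv hφ).mul hτ.continuousOn).add
      (hφ.continuousOn.mul (continuousOn_timeDeriv hτ))
  rw [integral_cylinder_symm hΓ (f := fun t x => timeDeriv φ t x * τ t x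
    + φ t x * timeDeriv τ t x) hcont]
  rw [integral_eq_zero_of_ae]
  filter_upwards [ae_restrict_mem hΓ.isCompact.measurableSet] with x hx
  have hd : ∀ t ∈ Icc (0 : ℝ) 1, HasDerivWithinAt (fun s => φ s x * τ s x)
      (timeDeriv φ t x * τ t x + φ t x * timeDeriv τ t x) (Icc 0 1) t := fun t ht =>
    (hasDerivWithinAt_timeDeriv hφ (z := (t, x)) ⟨ht, hx⟩).fun_mul
      (hasDerivWithinAt_timeDeriv hτ (z := (t, x)) ⟨ht, hx⟩)
  have hci : ContinuousOn (fun t => timeDeriv φ t x * τ t x + φ t x * timeDeriv τ t x)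
      (Icc 0 1) :=
    hcont.comp (f := fun t : ℝ => (t, x)) (by fun_prop) fun t ht => ⟨ht, hx⟩
  rw [intervalIntegral.integral_eq_sub_of_hasDerivAt_of_le zero_le_one
    (f := fun s => φ s x * τ s x) (fun t ht => (hd t ht).continuousWithinAt)
    (fun t ht => (hd t (Ioo_subset_Icc_self ht)).hasDerivAt (Icc_mem_nhds ht.1 ht.2))
    (hci.intervalIntegrable_of_Icc zero_le_one)]
  simp [h0, h1]

end Cylinder

end

/-! ### First variations of the Lagrangian and the saddle point conditions. -/

section

open Filter Topology
open scoped NNReal ENNReal RealInnerProductSpace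

/-- The polynomial has an interior minimum at `s = 0`, where its derivative is `a`. -/
lemma eq_zero_of_forall_nonneg_quadratic {a b ε : ℝ} (hε : 0 < ε)
    (h : ∀ s, |s| < ε → 0 ≤ s * a + s ^ 2 * b) : a = 0 := by
  have hd : HasDerivAt (fun s : ℝ => s * a + s ^ 2 * b) (1 * a + 2 * 0 * b) 0 := by
    simpa using ((hasDerivAt_id (0 : ℝ)).mul_const a).fun_add
      (((hasDerivAt_id (0 : ℝ)).fun_pow 2).mul_const b)
  have hmin : IsLocalMin (fun s : ℝ => s * a + s ^ 2 * b) 0 := by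
    filter_upwards [Metric.ball_mem_nhds (0 : ℝ) hε] with s hs
    simpa using h s (by simpa using hs)
  simpa using hmin.hasDerivAt_eq_zero hd

section

variable {Γ : Set E3} {η : ℝ} {ρ₀ ρ₁ : E3 → ℝ} {u : Flow} {p : Multiplier}

lemma IsAdmissibleFlow.contDiffOn_flux (hu : IsAdmissibleFlow Γ u) :
    ContDiffOn ℝ 1 (fun z : ℝ × E3 => u.ρ z.1 z.2 • u.v z.1 z.2) (cylinder Γ) :=
  hu.contDiffOn_ρ.smul hu.contDiffOn_v

lemma IsAdmissibleFlow.continuousOn_continuityResidual (hΓ : IsClosedSurface Γ)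
    (hu : IsAdmissibleFlow Γ u) :
    ContinuousOn (fun z : ℝ × E3 => continuityResidual Γ u z.1 z.2) (cylinder Γ) :=
  ((continuousOn_timeDeriv hu.contDiffOn_ρ).add
    (continuousOn_surfaceDiv hΓ (F := fun t y => u.ρ t y • u.v t y) hu.contDiffOn_flux)).sub
    (hu.contDiffOn_ρ.continuousOn.mul hu.continuousOn_g)

lemma IsAdmissibleFlow.continuousOn_costDensity (hu : IsAdmissibleFlow Γ u) :
    ContinuousOn (fun z : ℝ × E3 => 1 / 2 * u.ρ z.1 z.2 * ‖u.v z.1 z.2‖ ^ 2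
      + 1 / η * u.ρ z.1 z.2 * u.g z.1 z.2 ^ 2) (cylinder Γ) :=
  ((continuousOn_const.mul hu.contDiffOn_ρ.continuousOn).mul
    (hu.contDiffOn_v.continuousOn.norm.pow 2)).add
    ((continuousOn_const.mul hu.contDiffOn_ρ.continuousOn).mul (hu.continuousOn_g.pow 2))

/-- The space-time density of the Lagrangian. -/
def lagrangianDensity (Γ : Set E3) (η : ℝ) (u : Flow) (p : Multiplier) (z : ℝ × E3) : ℝ :=
  1 / 2 * u.ρ z.1 z.2 * ‖u.v z.1 z.2‖ ^ 2 + 1 / η * u.ρ z.1 z.2 * u.g z.1 z.2 ^ 2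
    + p.φ z.1 z.2 * continuityResidual Γ u z.1 z.2

lemma continuousOn_lagrangianDensity (hΓ : IsClosedSurface Γ) (hu : IsAdmissibleFlow Γ u)
    (hp : IsAdmissibleMultiplier Γ p) :
    ContinuousOn (lagrangianDensity Γ η u p) (cylinder Γ) :=
  hu.continuousOn_costDensity.add
    (hp.contDiffOn_φ.continuousOn.mul (hu.continuousOn_continuityResidual hΓ))

lemma lagrangian_eq (hΓ : IsClosedSurface Γ) (hu : IsAdmissibleFlow Γ u)
    (hp : IsAdmissibleMultiplier Γ p) :
    lagrangian Γ η ρ₀ ρ₁ u p = (∫ z, lagrangianDensity Γ η u p z ∂(cylinderMeasure Γ))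
      + (∫ x, p.φ₁ x * (u.ρ 0 x - ρ₀ x) ∂(surfaceMeasure Γ))
      + (∫ x, p.φ₂ x * (u.ρ 1 x - ρ₁ x) ∂(surfaceMeasure Γ)) := by
  have h1 : ContinuousOn (fun z : ℝ × E3 => p.φ z.1 z.2 * continuityResidual Γ u z.1 z.2)
      (cylinder Γ) :=
    hp.contDiffOn_φ.continuousOn.mul (hu.continuousOn_continuityResidual hΓ)
  rw [lagrangian, cost, ← integral_cylinder hΓ (hu.continuousOn_costDensity (η := η)),
    ← integral_cylinder hΓ (f := fun t x => p.φ t x * continuityResidual Γ u t x) h1,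
    ← integral_add (integrable_cylinder hΓ hu.continuousOn_costDensity)
      (integrable_cylinder hΓ h1)]
  rfl

/-- The first variation of the Lagrangian vanishes at a minimum along a family of flows with the
same initial and terminal densities. -/
lemma IsLagrangianSaddlePoint.integral_firstVariation_eq_zero (hΓ : IsClosedSurface Γ)
    (hs : IsLagrangianSaddlePoint Γ η ρ₀ ρ₁ u p) {U : ℝ → Flow} {ε : ℝ} (hε : 0 < ε)
    (hU : ∀ s, |s| < ε → IsAdmissibleFlow Γ (U s))
    (hU0 : ∀ s x, (U s).ρ 0 x = u.ρ 0 x) (hU1 : ∀ s x, (U s).ρ 1 x = u.ρ 1 x)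
    {A B : ℝ × E3 → ℝ} (hA : ContinuousOn A (cylinder Γ)) (hB : ContinuousOn B (cylinder Γ))
    (hAB : ∀ s, ∀ z ∈ cylinder Γ,
      lagrangianDensity Γ η (U s) p z = lagrangianDensity Γ η u p z + s * A z + s ^ 2 * B z) :
    ∫ z, A z ∂(cylinderMeasure Γ) = 0 := by
  refine eq_zero_of_forall_nonneg_quadratic (b := ∫ z, B z ∂(cylinderMeasure Γ)) hε
    fun s hsε => ?_
  have h := hs.isSaddlePointOn (U s) (hU s hsε) p hs.admissible_multiplier
  rw [lagrangian_eq hΓ hs.admissible_flow hs.admissible_multiplier,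
    lagrangian_eq hΓ (hU s hsε) hs.admissible_multiplier] at h
  simp only [hU0, hU1, add_le_add_iff_right] at h
  have hI0 := integrable_cylinder hΓ
    (continuousOn_lagrangianDensity (η := η) hΓ hs.admissible_flow hs.admissible_multiplier)
  have hIA := (integrable_cylinder hΓ hA).const_mul s
  have hIB := (integrable_cylinder hΓ hB).const_mul (s ^ 2)
  have h1 : ∫ z, lagrangianDensity Γ η (U s) p z ∂(cylinderMeasure Γ)
      = ∫ z, (lagrangianDensity Γ η u p z + s * A z + s ^ 2 * B z) ∂(cylinderMeasure Γ) := by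
    refine integral_congr_ae ?_
    filter_upwards [ae_mem_cylinder hΓ] with z hz using hAB s z hz
  have h2 : ∫ z, (lagrangianDensity Γ η u p z + s * A z + s ^ 2 * B z) ∂(cylinderMeasure Γ)
      = (∫ z, lagrangianDensity Γ η u p z ∂(cylinderMeasure Γ))
        + s * (∫ z, A z ∂(cylinderMeasure Γ)) + s ^ 2 * ∫ z, B z ∂(cylinderMeasure Γ) := by
    rw [← integral_const_mul, ← integral_const_mul, ← integral_add hI0 hIA]
    exact integral_add (hI0.add hIA) hIB
  rw [h1, h2] at h
  linarith

/-- The optimal growth rate is `g = (η / 2) φ`. -/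
lemma IsLagrangianSaddlePoint.growth_eq (hΓ : IsClosedSurface Γ) (hη : 0 < η)
    (hs : IsLagrangianSaddlePoint Γ η ρ₀ ρ₁ u p) :
    ∀ t ∈ Icc (0 : ℝ) 1, ∀ x ∈ Γ, u.g t x = η / 2 * p.φ t x := by
  have hu := hs.admissible_flow
  have hp := hs.admissible_multiplier
  have hf : ContinuousOn (fun z : ℝ × E3 => u.ρ z.1 z.2 * (2 / η * u.g z.1 z.2 - p.φ z.1 z.2))
      (cylinder Γ) :=
    hu.contDiffOn_ρ.continuousOn.mul
      ((continuousOn_const.mul hu.continuousOn_g).sub hp.contDiffOn_φ.continuousOn)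
  have key := eqOn_zero_of_forall_integral_mul_eq_zero hΓ hf fun χ hχ => by
    have hχc : ContinuousOn χ (cylinder Γ) := hχ.continuous.continuousOn
    refine hs.integral_firstVariation_eq_zero hΓ
      (U := fun s => ⟨u.ρ, u.v, fun t x => u.g t x + s * χ (t, x)⟩) one_pos
      (fun s _ => ⟨hu.contDiffOn_ρ, hu.ρ_pos, hu.contDiffOn_v, hu.v_mem,
        hu.continuousOn_g.add (continuousOn_const.mul hχc)⟩) (fun _ _ => rfl) (fun _ _ => rfl)
      (B := fun z => 1 / η * u.ρ z.1 z.2 * χ z ^ 2) (hf.mul hχc)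
      ((continuousOn_const.mul hu.contDiffOn_ρ.continuousOn).mul (hχc.pow 2)) fun s z _ => ?_
    simp only [lagrangianDensity, continuityResidual]
    ring
  intro t ht x hx
  have h1 := (mul_eq_zero.1 (key (t, x) ⟨ht, hx⟩)).resolve_left (hu.ρ_pos t ht x hx).ne'
  simp only at h1
  field_simp at h1 ⊢
  linarith

/-- The optimal velocity is `v = ∇_Γ φ`. -/
lemma IsLagrangianSaddlePoint.velocity_eq (hΓ : IsClosedSurface Γ)
    (hs : IsLagrangianSaddlePoint Γ η ρ₀ ρ₁ u p) :
    ∀ t ∈ Icc (0 : ℝ) 1, ∀ x ∈ Γ, u.v t x = surfaceGrad Γ (p.φ t) x := by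
  have hu := hs.admissible_flow
  have hp := hs.admissible_multiplier
  have hgrad := continuousOn_surfaceGrad hΓ hp.contDiffOn_φ
  have key : ∀ e : E3, ∀ z ∈ cylinder Γ,
      u.ρ z.1 z.2 * ⟪u.v z.1 z.2 - surfaceGrad Γ (p.φ z.1) z.2, e⟫ = 0 := fun e => by
    refine eqOn_zero_of_forall_integral_mul_eq_zero hΓ (hu.contDiffOn_ρ.continuousOn.mul
      ((hu.contDiffOn_v.continuousOn.sub hgrad).inner continuousOn_const)) fun χ hχ => ?_
    -- Velocity variations must be tangential and `C¹`; projecting a constant vector `e` achieves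
    -- both.
    let w : ℝ → E3 → E3 := fun t x => χ (t, x) • tangentProj Γ x e
    have hw : ContDiffOn ℝ 1 (fun z : ℝ × E3 => w z.1 z.2) (cylinder Γ) :=
      hχ.contDiffOn.smul ((hΓ.contDiffOn_tangentProj.comp contDiffOn_snd fun z hz => hz.2).clm_apply
        contDiffOn_const)
    have hwt : ∀ t ∈ Icc (0 : ℝ) 1, ∀ x ∈ Γ, w t x ∈ tangentPlane Γ x := fun t _ x _ =>
      Submodule.smul_mem _ _ (tangentProj_mem e)
    have hρw : ContDiffOn ℝ 1 (fun z : ℝ × E3 => u.ρ z.1 z.2 • w z.1 z.2) (cylinder Γ) :=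
      hu.contDiffOn_ρ.smul hw
    have hA : ContinuousOn (fun z : ℝ × E3 => u.ρ z.1 z.2 * ⟪u.v z.1 z.2, w z.1 z.2⟫
        + p.φ z.1 z.2 * surfaceDiv Γ (fun y => u.ρ z.1 y • w z.1 y) z.2) (cylinder Γ) :=
      (hu.contDiffOn_ρ.continuousOn.mul (hu.contDiffOn_v.continuousOn.inner hw.continuousOn)).add
        (hp.contDiffOn_φ.continuousOn.mul
          (continuousOn_surfaceDiv hΓ (F := fun t y => u.ρ t y • w t y) hρw))
    have hsw : ∀ s : ℝ, ContDiffOn ℝ 1 (fun z : ℝ × E3 => s • w z.1 z.2) (cylinder Γ) :=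
      fun s => hw.const_smul s
    have h1 : ∫ z : ℝ × E3, (u.ρ z.1 z.2 * ⟪u.v z.1 z.2, w z.1 z.2⟫
        + p.φ z.1 z.2 * surfaceDiv Γ (fun y => u.ρ z.1 y • w z.1 y) z.2)
        ∂(cylinderMeasure Γ) = 0 := by
      refine hs.integral_firstVariation_eq_zero hΓ
        (U := fun s => ⟨u.ρ, fun t x => u.v t x + s • w t x, u.g⟩) one_pos
        (fun s _ => ⟨hu.contDiffOn_ρ, hu.ρ_pos, hu.contDiffOn_v.add (hsw s),
          fun t ht x hx => Submodule.add_mem _ (hu.v_mem t ht x hx)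
            (Submodule.smul_mem _ _ (hwt t ht x hx)), hu.continuousOn_g⟩)
        (fun _ _ => rfl) (fun _ _ => rfl)
        (B := fun z => 1 / 2 * u.ρ z.1 z.2 * ‖w z.1 z.2‖ ^ 2) hA
        ((continuousOn_const.mul hu.contDiffOn_ρ.continuousOn).mul (hw.continuousOn.norm.pow 2))
        fun s z hz => ?_
      have hdv := differentiableWithinAt_space (f := fun t y => u.ρ t y • u.v t y)
        hu.contDiffOn_flux hz
      have hdw := differentiableWithinAt_space (f := fun t y => u.ρ t y • w t y) hρw hz
      have hdiv : surfaceDiv Γ (fun y => u.ρ z.1 y • (u.v z.1 y + s • w z.1 y)) z.2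
          = surfaceDiv Γ (fun y => u.ρ z.1 y • u.v z.1 y) z.2
            + s * surfaceDiv Γ (fun y => u.ρ z.1 y • w z.1 y) z.2 := by
        rw [← surfaceDiv_const_smul hdw, ← surfaceDiv_add hdv (hdw.fun_const_smul s)]
        simp only [smul_add, smul_comm s]
      simp only [lagrangianDensity, continuityResidual]
      rw [hdiv, norm_add_sq_real, inner_smul_right, norm_smul, mul_pow, Real.norm_eq_abs, sq_abs]
      ring
    have h2 := integral_mul_surfaceDiv_add hΓ hp.contDiffOn_φ
      (W := fun t y => u.ρ t y • w t y) hρw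
      fun t ht x hx => Submodule.smul_mem _ _ (hwt t ht x hx)
    have h2c : ContinuousOn (fun z : ℝ × E3 => p.φ z.1 z.2
        * surfaceDiv Γ (fun y => u.ρ z.1 y • w z.1 y) z.2
        + ⟪surfaceGrad Γ (p.φ z.1) z.2, u.ρ z.1 z.2 • w z.1 z.2⟫) (cylinder Γ) :=
      (hp.contDiffOn_φ.continuousOn.mul
        (continuousOn_surfaceDiv hΓ (F := fun t y => u.ρ t y • w t y) hρw)).add
        (hgrad.inner hρw.continuousOn)
    -- Subtracting the integration by parts identity replaces `φ div_Γ (ρ w)` by `-∇_Γ φ · ρ w`.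
    have h3 := (integral_sub (integrable_cylinder hΓ hA) (integrable_cylinder hΓ h2c)).symm
    rw [h1, h2, sub_zero] at h3
    rw [h3]
    refine integral_congr_ae ?_
    filter_upwards [ae_mem_cylinder hΓ] with z hz
    have htan : u.v z.1 z.2 - surfaceGrad Γ (p.φ z.1) z.2 ∈ tangentPlane Γ z.2 :=
      Submodule.sub_mem _ (hu.v_mem z.1 hz.1 z.2 hz.2) (surfaceGrad_mem _)
    -- The left factor is tangential, so the projection on `e` can be dropped.
    have h4 : ⟪u.v z.1 z.2 - surfaceGrad Γ (p.φ z.1) z.2, e⟫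
        = ⟪u.v z.1 z.2, tangentProj Γ z.2 e⟫
          - ⟪surfaceGrad Γ (p.φ z.1) z.2, tangentProj Γ z.2 e⟫ := by
      rw [← inner_sub_left, ← inner_tangentProj_left, tangentProj_eq_self htan]
    rw [h4]
    simp only [w, inner_smul_right]
    ring
  intro t ht x hx
  -- The vector `e` is arbitrary, so it may be taken equal to the difference at the given point.
  have h1 := (mul_eq_zero.1 (key (u.v t x - surfaceGrad Γ (p.φ t) x) (t, x) ⟨ht, hx⟩)).resolve_left
    (hu.ρ_pos t ht x hx).ne'
  exact sub_eq_zero.1 (inner_self_eq_zero.1 h1)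

/-- Stationarity in the density, before the optimal velocity and growth rate are inserted. -/
lemma IsLagrangianSaddlePoint.density_stationarity (hΓ : IsClosedSurface Γ)
    (hs : IsLagrangianSaddlePoint Γ η ρ₀ ρ₁ u p) :
    ∀ t ∈ Icc (0 : ℝ) 1, ∀ x ∈ Γ,
      1 / 2 * ‖u.v t x‖ ^ 2 + 1 / η * u.g t x ^ 2 - timeDeriv p.φ t x
        - ⟪surfaceGrad Γ (p.φ t) x, u.v t x⟫ - p.φ t x * u.g t x = 0 := by
  have hu := hs.admissible_flow
  have hp := hs.admissible_multiplier
  have hgrad := continuousOn_surfaceGrad hΓ hp.contDiffOn_φ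
  have hq : ContinuousOn (fun z : ℝ × E3 => 1 / 2 * ‖u.v z.1 z.2‖ ^ 2 + 1 / η * u.g z.1 z.2 ^ 2
      - timeDeriv p.φ z.1 z.2 - ⟪surfaceGrad Γ (p.φ z.1) z.2, u.v z.1 z.2⟫
      - p.φ z.1 z.2 * u.g z.1 z.2) (cylinder Γ) :=
    ((((continuousOn_const.mul (hu.contDiffOn_v.continuousOn.norm.pow 2)).add
      (continuousOn_const.mul (hu.continuousOn_g.pow 2))).sub
      (continuousOn_timeDeriv hp.contDiffOn_φ)).sub
      (hgrad.inner hu.contDiffOn_v.continuousOn)).sub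
      (hp.contDiffOn_φ.continuousOn.mul hu.continuousOn_g)
  -- The weight `t (1 - t)` makes density variations vanish at both end times, so the `φ₁` and `φ₂`
  -- terms are unchanged and integration by parts in time has no boundary terms.
  have hθc : ContDiff ℝ 1 fun z : ℝ × E3 => z.1 * (1 - z.1) := by fun_prop
  have key := eqOn_zero_of_forall_integral_mul_eq_zero hΓ
    (f := fun z => (1 / 2 * ‖u.v z.1 z.2‖ ^ 2 + 1 / η * u.g z.1 z.2 ^ 2
      - timeDeriv p.φ z.1 z.2 - ⟪surfaceGrad Γ (p.φ z.1) z.2, u.v z.1 z.2⟫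
      - p.φ z.1 z.2 * u.g z.1 z.2) * (z.1 * (1 - z.1)))
    (hq.mul hθc.continuous.continuousOn) fun χ hχ => by
    let τ : ℝ → E3 → ℝ := fun t x => t * (1 - t) * χ (t, x)
    have hτ : ContDiffOn ℝ 1 (fun z : ℝ × E3 => τ z.1 z.2) (cylinder Γ) :=
      (hθc.mul hχ).contDiffOn
    have hτv : ContDiffOn ℝ 1 (fun z : ℝ × E3 => τ z.1 z.2 • u.v z.1 z.2) (cylinder Γ) :=
      hτ.smul hu.contDiffOn_v
    have hA : ContinuousOn (fun z : ℝ × E3 => 1 / 2 * τ z.1 z.2 * ‖u.v z.1 z.2‖ ^ 2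
        + 1 / η * τ z.1 z.2 * u.g z.1 z.2 ^ 2 + p.φ z.1 z.2 * (timeDeriv τ z.1 z.2
          + surfaceDiv Γ (fun y => τ z.1 y • u.v z.1 y) z.2 - τ z.1 z.2 * u.g z.1 z.2))
        (cylinder Γ) :=
      (((continuousOn_const.mul hτ.continuousOn).mul (hu.contDiffOn_v.continuousOn.norm.pow 2)).add
        ((continuousOn_const.mul hτ.continuousOn).mul (hu.continuousOn_g.pow 2))).add
        (hp.contDiffOn_φ.continuousOn.mul (((continuousOn_timeDeriv hτ).add
          (continuousOn_surfaceDiv hΓ (F := fun t y => τ t y • u.v t y) hτv)).sub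
          (hτ.continuousOn.mul hu.continuousOn_g)))
    -- By compactness `ρ ≥ ε (1 + |τ|)` for some `ε > 0`, so `ρ + s τ` stays positive for `|s| < ε`.
    -- The added 1 avoids division by zero.
    obtain ⟨ε, hε, hεb⟩ := hΓ.isCompact_cylinder.exists_forall_le'
      (f := fun z : ℝ × E3 => u.ρ z.1 z.2 / (1 + |τ z.1 z.2|)) (a := 0)
      (hu.contDiffOn_ρ.continuousOn.div (continuousOn_const.add hτ.continuousOn.abs)
        fun z _ => by positivity) fun z hz => by
          have := hu.ρ_pos z.1 hz.1 z.2 hz.2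
          positivity
    have h1 : ∫ z : ℝ × E3, (1 / 2 * τ z.1 z.2 * ‖u.v z.1 z.2‖ ^ 2
        + 1 / η * τ z.1 z.2 * u.g z.1 z.2 ^ 2 + p.φ z.1 z.2 * (timeDeriv τ z.1 z.2
          + surfaceDiv Γ (fun y => τ z.1 y • u.v z.1 y) z.2 - τ z.1 z.2 * u.g z.1 z.2))
        ∂(cylinderMeasure Γ) = 0 := by
      refine hs.integral_firstVariation_eq_zero hΓ
        (U := fun s => ⟨fun t x => u.ρ t x + s * τ t x, u.v, u.g⟩) hε
        (fun s hsε => ⟨hu.contDiffOn_ρ.add (contDiffOn_const.mul hτ), fun t ht x hx => ?_,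
          hu.contDiffOn_v, hu.v_mem, hu.continuousOn_g⟩)
        (fun s x => by simp [τ]) (fun s x => by simp [τ])
        -- There is no quadratic term because the Lagrangian is affine in `ρ`.
        (B := fun _ => 0) hA continuousOn_const fun s z hz => ?_
      · have h2 := hεb (t, x) ⟨ht, hx⟩
        simp only at h2
        rw [le_div_iff₀ (by positivity)] at h2
        have h3 : |s * τ t x| ≤ ε * |τ t x| := by
          rw [abs_mul]
          exact mul_le_mul_of_nonneg_right hsε.le (abs_nonneg _)
        have h4 := neg_abs_le (s * τ t x)
        simp only
        linarith
      · have hdv := differentiableWithinAt_space (f := fun t y => u.ρ t y • u.v t y)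
          hu.contDiffOn_flux hz
        have hdw := differentiableWithinAt_space (f := fun t y => τ t y • u.v t y) hτv hz
        have hdiv : surfaceDiv Γ (fun y => (u.ρ z.1 y + s * τ z.1 y) • u.v z.1 y) z.2
            = surfaceDiv Γ (fun y => u.ρ z.1 y • u.v z.1 y) z.2
              + s * surfaceDiv Γ (fun y => τ z.1 y • u.v z.1 y) z.2 := by
          rw [← surfaceDiv_const_smul hdw, ← surfaceDiv_add hdv (hdw.fun_const_smul s)]
          simp only [add_smul, mul_smul]
        have htd : timeDeriv (fun t x => u.ρ t x + s * τ t x) z.1 z.2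
            = timeDeriv u.ρ z.1 z.2 + s * timeDeriv τ z.1 z.2 :=
          timeDeriv_eq hz.1 ((hasDerivWithinAt_timeDeriv hu.contDiffOn_ρ hz).fun_add
            ((hasDerivWithinAt_timeDeriv hτ hz).const_mul s))
        simp only [lagrangianDensity, continuityResidual]
        rw [hdiv, htd]
        ring
    have h2 := integral_mul_surfaceDiv_add hΓ hp.contDiffOn_φ
      (W := fun t y => τ t y • u.v t y) hτv
      fun t ht x hx => Submodule.smul_mem _ _ (hu.v_mem t ht x hx)
    have h2c : ContinuousOn (fun z : ℝ × E3 => p.φ z.1 z.2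
        * surfaceDiv Γ (fun y => τ z.1 y • u.v z.1 y) z.2
        + ⟪surfaceGrad Γ (p.φ z.1) z.2, τ z.1 z.2 • u.v z.1 z.2⟫) (cylinder Γ) :=
      (hp.contDiffOn_φ.continuousOn.mul
        (continuousOn_surfaceDiv hΓ (F := fun t y => τ t y • u.v t y) hτv)).add
        (hgrad.inner hτv.continuousOn)
    have h3 := integral_mul_timeDeriv_add hΓ hp.contDiffOn_φ hτ (fun x => by simp [τ])
      (fun x => by simp [τ])
    have h3c : ContinuousOn (fun z : ℝ × E3 => timeDeriv p.φ z.1 z.2 * τ z.1 z.2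
        + p.φ z.1 z.2 * timeDeriv τ z.1 z.2) (cylinder Γ) :=
      ((continuousOn_timeDeriv hp.contDiffOn_φ).mul hτ.continuousOn).add
        (hp.contDiffOn_φ.continuousOn.mul (continuousOn_timeDeriv hτ))
    -- Removing the space and time integration by parts identities from the first variation leaves
    -- `τ` times the stationarity expression.
    have h4 := integral_sub ((integrable_cylinder hΓ hA).sub (integrable_cylinder hΓ h2c))
      (integrable_cylinder hΓ h3c)
    simp only [Pi.sub_apply] at h4
    rw [integral_sub (integrable_cylinder hΓ hA) (integrable_cylinder hΓ h2c), h1, h2, h3,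
      sub_zero, sub_zero] at h4
    rw [← h4]
    refine integral_congr_ae (Eventually.of_forall fun z => ?_)
    simp only [τ, inner_smul_right]
    ring
  intro t ht x hx
  set q : ℝ → ℝ := fun t => 1 / 2 * ‖u.v t x‖ ^ 2 + 1 / η * u.g t x ^ 2 - timeDeriv p.φ t x
        - ⟪surfaceGrad Γ (p.φ t) x, u.v t x⟫ - p.φ t x * u.g t x with hqdef
  have hqc : ContinuousOn q (Icc 0 1) :=
    hq.comp (f := fun t : ℝ => (t, x)) (by fun_prop) fun t ht => ⟨ht, hx⟩
  have hq0 : EqOn q (fun _ => 0) (Ioo 0 1) := fun s hs' =>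
    (mul_eq_zero.1 (key (s, x) ⟨Ioo_subset_Icc_self hs', hx⟩)).resolve_right
      (mul_pos hs'.1 (sub_pos.2 hs'.2)).ne'
  -- The weight `t (1 - t)` gives no information at the end times; continuity supplies them.
  exact hq0.of_subset_closure hqc continuousOn_const Ioo_subset_Icc_self
    (by rw [closure_Ioo zero_ne_one]) ht

lemma lagrangian_add_φ (hΓ : IsClosedSurface Γ) (hu : IsAdmissibleFlow Γ u)
    (hp : IsAdmissibleMultiplier Γ p) {χ : ℝ → E3 → ℝ}
    (hχ : ContDiffOn ℝ 1 (fun z : ℝ × E3 => χ z.1 z.2) (cylinder Γ)) :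
    lagrangian Γ η ρ₀ ρ₁ u ⟨fun t x => p.φ t x + χ t x, p.φ₁, p.φ₂⟩
      = lagrangian Γ η ρ₀ ρ₁ u p
        + ∫ z, continuityResidual Γ u z.1 z.2 * χ z.1 z.2 ∂(cylinderMeasure Γ) := by
  have hR := hu.continuousOn_continuityResidual hΓ
  rw [lagrangian_eq hΓ hu hp,
    lagrangian_eq (p := ⟨fun t x => p.φ t x + χ t x, p.φ₁, p.φ₂⟩) hΓ hu
      ⟨hp.contDiffOn_φ.add hχ, hp.continuousOn_φ₁, hp.continuousOn_φ₂⟩]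
  have h1 : ∫ z, lagrangianDensity Γ η u ⟨fun t x => p.φ t x + χ t x, p.φ₁, p.φ₂⟩ z
      ∂(cylinderMeasure Γ) = ∫ z, (lagrangianDensity Γ η u p z
        + continuityResidual Γ u z.1 z.2 * χ z.1 z.2) ∂(cylinderMeasure Γ) := by
    refine integral_congr_ae (Eventually.of_forall fun z => ?_)
    simp only [lagrangianDensity]
    ring
  have h2 : ∫ z, (lagrangianDensity Γ η u p z + continuityResidual Γ u z.1 z.2 * χ z.1 z.2)
      ∂(cylinderMeasure Γ) = _ :=
    integral_add (integrable_cylinder hΓ (continuousOn_lagrangianDensity hΓ hu hp))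
      (integrable_cylinder hΓ (hR.mul hχ.continuousOn))
  rw [h1, h2]
  dsimp only
  ring

/-- The Lagrangian is affine in `φ`, so maximality at `p` tested with both `χ` and `-χ` annihilates
the integral of the residual against `χ`. -/
lemma IsLagrangianSaddlePoint.continuityResidual_eq_zero (hΓ : IsClosedSurface Γ)
    (hs : IsLagrangianSaddlePoint Γ η ρ₀ ρ₁ u p) :
    ∀ z ∈ cylinder Γ, continuityResidual Γ u z.1 z.2 = 0 := by
  have hu := hs.admissible_flow
  have hp := hs.admissible_multiplier
  refine eqOn_zero_of_forall_integral_mul_eq_zero hΓ (hu.continuousOn_continuityResidual hΓ)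
    fun χ hχ => ?_
  have hle : ∀ χ : ℝ × E3 → ℝ, ContDiff ℝ 1 χ →
      ∫ z, continuityResidual Γ u z.1 z.2 * χ z ∂(cylinderMeasure Γ) ≤ 0 := fun χ hχ => by
    have h := hs.isSaddlePointOn u hu ⟨fun t x => p.φ t x + χ (t, x), p.φ₁, p.φ₂⟩
      ⟨hp.contDiffOn_φ.add hχ.contDiffOn, hp.continuousOn_φ₁, hp.continuousOn_φ₂⟩
    rw [lagrangian_add_φ hΓ hu hp (χ := fun t x => χ (t, x)) hχ.contDiffOn] at h
    simpa using h
  refine le_antisymm (hle χ hχ) ?_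
  have h := hle (fun z => -χ z) hχ.neg
  simp only [mul_neg, integral_neg] at h
  linarith

lemma eq_zero_of_integral_mul_self_nonpos (hΓ : IsClosedSurface Γ) {f : E3 → ℝ}
    (hf : ContinuousOn f Γ) (h : ∫ x, f x * f x ∂(surfaceMeasure Γ) ≤ 0) : ∀ x ∈ Γ, f x = 0 := by
  have h0 := eqOn_zero_of_integral_eq_zero (μ := surfaceMeasure Γ) (K := Γ)
    (fun O hO x hx hxO => hΓ.measure_pos_of_isOpen hO hx hxO)
    (ae_restrict_mem hΓ.isCompact.measurableSet) (hf.mul hf) (hΓ.integrable (hf.mul hf))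
    (fun x _ => mul_self_nonneg _) (le_antisymm h (integral_nonneg fun x => mul_self_nonneg _))
  exact fun x hx => mul_self_eq_zero.1 (h0 x hx)

/-- Adding the defect `ρ(0, ·) - ρ₀` to `φ₁` raises the Lagrangian by the integral of its square,
which maximality forbids unless the defect vanishes. Continuity of `ρ₀` makes this an admissible
multiplier. -/
lemma IsLagrangianSaddlePoint.initial_eq (hΓ : IsClosedSurface Γ) (hρ₀ : ContinuousOn ρ₀ Γ)
    (hs : IsLagrangianSaddlePoint Γ η ρ₀ ρ₁ u p) : ∀ x ∈ Γ, u.ρ 0 x = ρ₀ x := by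
  have hu := hs.admissible_flow
  have hp := hs.admissible_multiplier
  have hd : ContinuousOn (fun x => u.ρ 0 x - ρ₀ x) Γ :=
    (contDiffOn_space hu.contDiffOn_ρ (left_mem_Icc.2 zero_le_one)).continuousOn.sub hρ₀
  have h := hs.isSaddlePointOn u hu ⟨p.φ, fun x => p.φ₁ x + (u.ρ 0 x - ρ₀ x), p.φ₂⟩
    ⟨hp.contDiffOn_φ, hp.continuousOn_φ₁.add hd, hp.continuousOn_φ₂⟩
  simp only [lagrangian, add_mul] at h
  have hadd : ∫ x, (p.φ₁ x * (u.ρ 0 x - ρ₀ x) + (u.ρ 0 x - ρ₀ x) * (u.ρ 0 x - ρ₀ x))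
      ∂(surfaceMeasure Γ) = _ :=
    integral_add (hΓ.integrable (hp.continuousOn_φ₁.mul hd)) (hΓ.integrable (hd.mul hd))
  rw [hadd] at h
  exact fun x hx => sub_eq_zero.1 (eq_zero_of_integral_mul_self_nonpos hΓ hd (by linarith) x hx)

lemma IsLagrangianSaddlePoint.terminal_eq (hΓ : IsClosedSurface Γ) (hρ₁ : ContinuousOn ρ₁ Γ)
    (hs : IsLagrangianSaddlePoint Γ η ρ₀ ρ₁ u p) : ∀ x ∈ Γ, u.ρ 1 x = ρ₁ x := by
  have hu := hs.admissible_flow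
  have hp := hs.admissible_multiplier
  have hd : ContinuousOn (fun x => u.ρ 1 x - ρ₁ x) Γ :=
    (contDiffOn_space hu.contDiffOn_ρ (right_mem_Icc.2 zero_le_one)).continuousOn.sub hρ₁
  have h := hs.isSaddlePointOn u hu ⟨p.φ, p.φ₁, fun x => p.φ₂ x + (u.ρ 1 x - ρ₁ x)⟩
    ⟨hp.contDiffOn_φ, hp.continuousOn_φ₁, hp.continuousOn_φ₂.add hd⟩
  simp only [lagrangian, add_mul] at h
  have hadd : ∫ x, (p.φ₂ x * (u.ρ 1 x - ρ₁ x) + (u.ρ 1 x - ρ₁ x) * (u.ρ 1 x - ρ₁ x))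
      ∂(surfaceMeasure Γ) = _ :=
    integral_add (hΓ.integrable (hp.continuousOn_φ₂.mul hd)) (hΓ.integrable (hd.mul hd))
  rw [hadd] at h
  exact fun x hx => sub_eq_zero.1 (eq_zero_of_integral_mul_self_nonpos hΓ hd (by linarith) x hx)

/-- On feasible flows the Lagrangian is the cost. -/
lemma lagrangian_eq_cost (hΓ : IsClosedSurface Γ) (hu : u ∈ feasible Γ ρ₀ ρ₁) (p : Multiplier) :
    lagrangian Γ η ρ₀ ρ₁ u p = cost Γ η u := by
  obtain ⟨-, hcont, h0, h1⟩ := hu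
  have hae := ae_restrict_mem (μ := (Measure.euclideanHausdorffMeasure 2 : Measure E3))
    hΓ.isCompact.measurableSet
  have hI0 : ∫ x, p.φ₁ x * (u.ρ 0 x - ρ₀ x) ∂(surfaceMeasure Γ) = 0 := by
    refine integral_eq_zero_of_ae ?_
    filter_upwards [hae] with x hx
    simp [h0 x hx]
  have hI1 : ∫ x, p.φ₂ x * (u.ρ 1 x - ρ₁ x) ∂(surfaceMeasure Γ) = 0 := by
    refine integral_eq_zero_of_ae ?_
    filter_upwards [hae] with x hx
    simp [h1 x hx]
  have hI : ∫ t in (0 : ℝ)..1, ∫ x, p.φ t x * continuityResidual Γ u t x ∂(surfaceMeasure Γ)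
      = 0 := by
    -- Feasibility imposes the continuity equation only on the open time interval, which has full
    -- measure.
    rw [intervalIntegral.integral_of_le zero_le_one, integral_Ioc_eq_integral_Ioo]
    refine setIntegral_eq_zero_of_forall_eq_zero fun t ht => integral_eq_zero_of_ae ?_
    filter_upwards [hae] with x hx
    simp [continuityResidual, hcont t ht x hx]
  rw [lagrangian, hI0, hI1, hI, add_zero, add_zero, add_zero]

end

end

end MUOT

end

/-! ### The KKT system and optimality. -/

theorem theorem3p1 (Γ : Set MUOT.E3) (hΓ : MUOT.IsClosedSurface Γ) (η : ℝ) (hη : 0 < η)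
    (ρ₀ ρ₁ : MUOT.E3 → ℝ) (hρ₀ : ContinuousOn ρ₀ Γ) (hρ₁ : ContinuousOn ρ₁ Γ)
    (u : MUOT.Flow) (p : MUOT.Multiplier)
    (hsaddle : MUOT.IsLagrangianSaddlePoint Γ η ρ₀ ρ₁ u p) :
    (∀ t ∈ Icc (0 : ℝ) 1, ∀ x ∈ Γ, u.v t x = MUOT.surfaceGrad Γ (p.φ t) x) ∧
    (∀ t ∈ Icc (0 : ℝ) 1, ∀ x ∈ Γ, u.g t x = η / 2 * p.φ t x) ∧
    MUOT.IsKKTSolution Γ η ρ₀ ρ₁ u.ρ p.φ ∧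
    u ∈ MUOT.feasible Γ ρ₀ ρ₁ ∧
    IsMinOn (MUOT.cost Γ η) (MUOT.feasible Γ ρ₀ ρ₁) u := by
  have hu := hsaddle.admissible_flow
  have hp := hsaddle.admissible_multiplier
  have hv := hsaddle.velocity_eq hΓ
  have hg := hsaddle.growth_eq hΓ hη
  have hR := hsaddle.continuityResidual_eq_zero hΓ
  have h0 := hsaddle.initial_eq hΓ hρ₀
  have h1 := hsaddle.terminal_eq hΓ hρ₁
  have hcont : ∀ t ∈ Icc (0 : ℝ) 1, ∀ x ∈ Γ, MUOT.timeDeriv u.ρ t x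
      + MUOT.surfaceDiv Γ (fun y => u.ρ t y • u.v t y) x = u.ρ t x * u.g t x :=
    fun t ht x hx => sub_eq_zero.1 (hR (t, x) ⟨ht, hx⟩)
  have hfeas : u ∈ MUOT.feasible Γ ρ₀ ρ₁ :=
    ⟨hu, fun t ht x hx => hcont t (Ioo_subset_Icc_self ht) x hx, h0, h1⟩
  refine ⟨hv, hg, ⟨hu.contDiffOn_ρ, hu.ρ_pos, hp.contDiffOn_φ, ?_, ?_, ?_, h0, h1⟩, hfeas, ?_⟩
  -- Although `φ` is only assumed `C¹`, its tangential gradient equals the `C¹` field `v`.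
  · exact hu.contDiffOn_v.congr fun z hz => (hv z.1 hz.1 z.2 hz.2).symm
  · intro t ht x hx
    have ht' := Ioo_subset_Icc_self ht
    have h := hcont t ht' x hx
    rw [MUOT.surfaceDiv_congr (G := fun y => u.ρ t y • MUOT.surfaceGrad Γ (p.φ t) y)
      (fun y hy => by simp only [hv t ht' y hy]) hx, hg t ht' x hx] at h
    rw [h]
    ring
  · intro t ht x hx
    have h := hsaddle.density_stationarity hΓ t ht x hx
    rw [hv t ht x hx, hg t ht x hx, real_inner_self_eq_norm_sq] at h
    field_simp at h ⊢
    linarith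
  · intro w hw
    -- Both flows are feasible, so the saddle inequality compares their costs directly.
    have h := hsaddle.isSaddlePointOn w hw.1 p hp
    rwa [MUOT.lagrangian_eq_cost hΓ hfeas, MUOT.lagrangian_eq_cost hΓ hw] at h
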